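/- Let $(\widetilde M,f,\xi_1,\xi_2,\eta_1,\eta_2,g)$ be a $(2m+2)$-dimensional metric $f$-manifold with two structure vector fields, i.e. a Riemannian manifold with a smooth $(1,1)$-tensor field $f$, vector fields $\xi_1,\xi_2$ and dual $1$-forms $\eta_1,\eta_2$ such that $\eta_\alpha(\xi_\beta)=\delta_{\alpha\beta}$, $f\xi_\alpha=0$, $\eta_\alpha\circ f=0$, $f^2=-I+\sum_\alpha\eta_\alpha\otimes\xi_\alpha$ and $g(X,Y)=g(fX,fY)+\sum_\alpha\eta_\alpha(X)\eta_\alpha(Y)$. Suppose that $\widetilde M$ is a $C$-manifold: $[f,f]+2\sum_\alpha\xi_\alpha\otimes d\eta_\alpha=0$, $dF=0$ for $F(X,Y)=g(X,fY)$, and $d\eta_1=d\eta_2=0$. Suppose also that $\widetilde M$ is a generalized $S$-space-form: there are smooth functions $F_1,F_2,F_3,F_{11},F_{12},F_{21},F_{22}$ on $\widetilde M$ with $\widetilde R=\sum_{i=1}^3F_i\widetilde R_i+\sum_{i,j=1}^2F_{ij}\widetilde R_{ij}$, where $$\begin{aligned}\widetilde R_1(X,Y)Z&=g(Y,Z)X-g(X,Z)Y,\\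 \widetilde R_2(X,Y)Z&=g(X,fZ)fY-g(Y,fZ)fX+2g(X,fY)fZ,\\ \widetilde R_3(X,Y)Z&=\eta_1(X)\eta_2(Y)\eta_2(Z)\xi_1-\eta_2(X)\eta_1(Y)\eta_2(Z)\xi_1+\eta_2(X)\eta_1(Y)\eta_1(Z)\xi_2-\eta_1(X)\eta_2(Y)\eta_1(Z)\xi_2,\\ \widetilde R_{ij}(X,Y)Z&=\eta_i(X)\eta_j(Z)Y-\eta_i(Y)\eta_j(Z)X+g(X,Z)\eta_i(Y)\xi_j-g(Y,Z)\eta_i(X)\xi_j.\end{aligned}$$ If $m=1$ (when $\widetilde R$ determines only $F_1+3F_2$, and not $F_1$ and $F_2$ separately), let these functions be chosen with $F_1=F_2$. Let $M$ be an $(n+2)$-dimensional Riemannian manifold, $n\ge 2$, isometrically immersed in $\widetilde M$ and tangent to $\xi_1$ and $\xi_2$. Let $\mathcal L$ be the distribution on $M$ orthogonal to $\xi_1,\xi_2$, $\sigma$ the second fundamental form, $H=\frac1{n+2}\operatorname{trace}\sigma$ the mean curvature vector, $\mathrm{Ric}(U)$ the Ricci curvature of $M$ in the direction $U$, and $TU$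 the component of $fU$ tangent to $M$. Then, at every point of $M$ and for every unit vector $U\in\mathcal L$, $$\mathrm{Ric}(U)\le\frac{(n+2)^2}{4}\|H\|^2+\bigl\{(n-1)+3\|TU\|^2\bigr\}F_1 .$$ Moreover, equality holds for all unit $U\in\mathcal L$ (at all points of $M$) if and only if either $n=2$ and $M$ is totally $f$-umbilical (there is a normal vector field $V$ with $\sigma(X,Y)=g(X,Y)V$ for all $X,Y\in\mathcal L$), or $n>2$ and $M$ is totally geodesic ($\sigma\equiv0$). -/

import Mathlib

open scoped Manifold ContDiff Bundle
open Bundle (RiemannianBundle)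

set_option maxSynthPendingDepth 3

noncomputable section

/-! ### Riemannian geometry of a metric on an open part of a vector space -/

namespace LocalRiemann

variable {E : Type*} [NormedAddCommGroup E] [NormedSpace ℝ E]

/-- `∂_w G(u, v)`, as a trilinear form in `u`, `v`, `w`. -/
def derivLast (G : E → E →L[ℝ] E →L[ℝ] ℝ) (y : E) : E →L[ℝ] E →L[ℝ] E →L[ℝ] ℝ :=
  ((ContinuousLinearMap.flipₗᵢ ℝ E E ℝ).toContinuousLinearEquiv :
      (E →L[ℝ] E →L[ℝ] ℝ) →L[ℝ] (E →L[ℝ] E →L[ℝ] ℝ)) ∘L (fderiv ℝ G y).flip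

/-- The Christoffel symbols of the first kind of the metric `G`: the covector
`w ↦ (1/2) (∂_u G(v, w) + ∂_v G(u, w) - ∂_w G(u, v))`, bilinear in `u` and `v`. -/
def christoffelFirst (G : E → E →L[ℝ] E →L[ℝ] ℝ) (y : E) : E →L[ℝ] E →L[ℝ] E →L[ℝ] ℝ :=
  (1 / 2 : ℝ) • (fderiv ℝ G y + (fderiv ℝ G y).flip - derivLast G y)

theorem christoffelFirst_apply (G : E → E →L[ℝ] E →L[ℝ] ℝ) (y u v w : E) :
    christoffelFirst G y u v w
      = (1 / 2) * (fderiv ℝ G y u v w + fderiv ℝ G y v u w - fderiv ℝ G y w u v) := by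
  simp [christoffelFirst, derivLast]

/-- The Christoffel symbols of the second kind `Γ(u, v) = ∇_u v` (for constant vector fields `u`
and `v`) of the Levi-Civita connection of `G`, i.e. `G(Γ(u, v), w) = christoffelFirst G u v w`:
the index is raised with the inverse of the musical isomorphism `u ↦ G(u, ·)`. -/
def christoffel (G : E → E →L[ℝ] E →L[ℝ] ℝ) (y : E) : E →L[ℝ] E →L[ℝ] E :=
  (ContinuousLinearMap.compL ℝ E (E →L[ℝ] ℝ) E (G y).inverse) ∘L christoffelFirst G y

theorem christoffel_apply (G : E → E →L[ℝ] E →L[ℝ] ℝ) (y u v : E) :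
    christoffel G y u v = (G y).inverse (christoffelFirst G y u v) := rfl

/-- The curvature `R(u, v) w = ∇_u ∇_v w - ∇_v ∇_u w - ∇_[u, v] w` of the Levi-Civita connection
of `G`, evaluated on constant vector fields. -/
def curvature (G : E → E →L[ℝ] E →L[ℝ] ℝ) (y u v w : E) : E :=
  fderiv ℝ (christoffel G) y u v w - fderiv ℝ (christoffel G) y v u w
    + christoffel G y u (christoffel G y v w) - christoffel G y v (christoffel G y u w)

/-- The exterior derivative of a 1-form, `2 dη(u, v) = ∂_u η(v) - ∂_v η(u)`, with the factor `1/2`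
that is customary in contact geometry. -/
def dOneForm (η : E → E →L[ℝ] ℝ) (y u v : E) : ℝ :=
  (1 / 2) * (fderiv ℝ η y u v - fderiv ℝ η y v u)

/-- The exterior derivative of a 2-form,
`3 dΩ(u, v, w) = ∂_u Ω(v, w) + ∂_v Ω(w, u) + ∂_w Ω(u, v)`. -/
def dTwoForm (Ω : E → E →L[ℝ] E →L[ℝ] ℝ) (y u v w : E) : ℝ :=
  (1 / 3) * (fderiv ℝ Ω y u v w + fderiv ℝ Ω y v w u + fderiv ℝ Ω y w u v)

/-- The Nijenhuis tensor `[f, f](u, v) = f² [u, v] + [f u, f v] - f [f u, v] - f [u, f v]`,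
evaluated on constant vector fields (with `[X, Y] = ∂_X Y - ∂_Y X`). -/
def nijenhuis (f : E → E →L[ℝ] E) (y u v : E) : E :=
  fderiv ℝ f y (f y u) v - fderiv ℝ f y (f y v) u
    + f y (fderiv ℝ f y v u) - f y (fderiv ℝ f y u v)

end LocalRiemann

/-! ### Riemannian manifolds, read in the charts of the manifold

The tangent space at `p` is, by definition in Mathlib, the model space `E`, the identification
being the differential at `p` of the preferred chart at `p`. -/

namespace RiemannChart

open LocalRiemann

variable {E : Type*} [NormedAddCommGroup E] [NormedSpace ℝ E]
  {M : Type*} [TopologicalSpace M] [ChartedSpace E M]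

/-- The coordinate frame at the point of coordinates `y` in the chart around `p`. -/
def frame (p : M) (y : E) :
    E →L[ℝ] TangentSpace 𝓘(ℝ, E) ((extChartAt 𝓘(ℝ, E) p).symm y) :=
  mfderiv 𝓘(ℝ, E) 𝓘(ℝ, E) (extChartAt 𝓘(ℝ, E) p).symm y

/-- The coordinates, in the chart around `p`, of the tangent vectors at `q`. -/
def coframe (p q : M) : TangentSpace 𝓘(ℝ, E) q →L[ℝ] E :=
  mfderiv 𝓘(ℝ, E) 𝓘(ℝ, E) (extChartAt 𝓘(ℝ, E) p) q

/-- A vector field in coordinates. -/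
def coordField (X : ∀ q : M, TangentSpace 𝓘(ℝ, E) q) (p : M) (y : E) : E :=
  coframe p _ (X ((extChartAt 𝓘(ℝ, E) p).symm y))

/-- A 1-form in coordinates. -/
def coordForm (η : ∀ q : M, TangentSpace 𝓘(ℝ, E) q →L[ℝ] ℝ) (p : M) (y : E) : E →L[ℝ] ℝ :=
  η ((extChartAt 𝓘(ℝ, E) p).symm y) ∘L frame p y

/-- A field of endomorphisms of the tangent spaces in coordinates. -/
def coordEndo (f : ∀ q : M, TangentSpace 𝓘(ℝ, E) q →L[ℝ] TangentSpace 𝓘(ℝ, E) q)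
    (p : M) (y : E) : E →L[ℝ] E :=
  coframe p _ ∘L f ((extChartAt 𝓘(ℝ, E) p).symm y) ∘L frame p y

variable [RiemannianBundle (fun q : M ↦ TangentSpace 𝓘(ℝ, E) q)]

/-- The Riemannian metric in coordinates. -/
def coordMetric (p : M) (y : E) : E →L[ℝ] E →L[ℝ] ℝ :=
  (innerSL ℝ : TangentSpace 𝓘(ℝ, E) ((extChartAt 𝓘(ℝ, E) p).symm y) →L[ℝ]
    TangentSpace 𝓘(ℝ, E) ((extChartAt 𝓘(ℝ, E) p).symm y) →L[ℝ] ℝ).bilinearComp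
      (frame p y) (frame p y)

theorem coordMetric_apply (p : M) (y u v : E) :
    coordMetric p y u v = inner ℝ (frame p y u) (frame p y v) := rfl

/-- The Riemann curvature tensor `R(u, v) w` at `p`. -/
def riemann (p : M) (u v w : TangentSpace 𝓘(ℝ, E) p) : TangentSpace 𝓘(ℝ, E) p :=
  curvature (E := E) (coordMetric p) (extChartAt 𝓘(ℝ, E) p p) u v w

variable [FiniteDimensional ℝ E]

/-- On a Riemannian manifold the inverse in the definition of `christoffel` is a genuine one, so that
`christoffel` gives the Levi-Civita connection (Koszul formula). -/
theorem coordMetric_christoffel [IsManifold 𝓘(ℝ, E) ∞ M] (p : M) (y : E)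
    (hy : y ∈ (extChartAt 𝓘(ℝ, E) p).target) (u v w : E) :
    coordMetric p y (christoffel (coordMetric p) y u v) w
      = christoffelFirst (coordMetric p) y u v w := by
  have inj : Function.Injective (frame p y) := by
    have h := isInvertible_mfderivWithin_extChartAt_symm (I := 𝓘(ℝ, E)) (x := p) hy
    simp only [modelWithCornersSelf_coe, Set.range_id, mfderivWithin_univ] at h
    exact h.injective
  have hi : Function.Injective (coordMetric p y) := by
    rw [injective_iff_map_eq_zero]
    intro a ha
    have : (inner ℝ (frame p y a) (frame p y a) : ℝ) = 0 := by
      rw [← coordMetric_apply, ha]; rfl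
    rw [inner_self_eq_zero] at this
    exact inj (by rw [this]; exact (map_zero _).symm)
  have hd : Module.finrank ℝ E = Module.finrank ℝ (E →L[ℝ] ℝ) := by
    rw [← (LinearMap.toContinuousLinearMap (𝕜 := ℝ) (E := E) (F' := ℝ)).finrank_eq]
    exact (Subspace.dual_finrank_eq (K := ℝ) (V := E)).symm
  let e := (LinearEquiv.ofInjectiveOfFinrankEq (coordMetric p y).toLinearMap hi
    hd).toContinuousLinearEquiv
  have he : (e : E →L[ℝ] (E →L[ℝ] ℝ)) = coordMetric p y := by ext; rfl
  rw [christoffel_apply, ← he, ContinuousLinearMap.inverse_equiv]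
  simp

instance tangentFiniteDimensional (p : M) : FiniteDimensional ℝ (TangentSpace 𝓘(ℝ, E) p) :=
  inferInstanceAs (FiniteDimensional ℝ E)

variable (E) in
/-- An orthonormal basis of the tangent space at `p`. -/
def orthoBasis (p : M) : OrthonormalBasis (Fin (Module.finrank ℝ (TangentSpace 𝓘(ℝ, E) p))) ℝ
    (TangentSpace 𝓘(ℝ, E) p) :=
  stdOrthonormalBasis ℝ (TangentSpace 𝓘(ℝ, E) p)

/-- The Ricci curvature `Ric(u) = ∑ᵢ ⟨R(eᵢ, u) u, eᵢ⟩`. -/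
def ricci (p : M) (u : TangentSpace 𝓘(ℝ, E) p) : ℝ :=
  ∑ i, inner ℝ (riemann p (orthoBasis E p i) u u) (orthoBasis E p i)

end RiemannChart

/-! ### Isometric immersions -/

namespace Immersed

open LocalRiemann RiemannChart

variable {E : Type*} [NormedAddCommGroup E] [NormedSpace ℝ E]
  {M : Type*} [TopologicalSpace M] [ChartedSpace E M]
  [RiemannianBundle (fun q : M ↦ TangentSpace 𝓘(ℝ, E) q)]
  {E' : Type*} [NormedAddCommGroup E'] [NormedSpace ℝ E']
  {M' : Type*} [TopologicalSpace M'] [ChartedSpace E' M']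
  [RiemannianBundle (fun q : M' ↦ TangentSpace 𝓘(ℝ, E') q)]

variable (E E') in
/-- A smooth map that preserves the metrics (so that its differential is injective). -/
structure IsIsometricImmersion (φ : M → M') : Prop where
  smooth : ContMDiff 𝓘(ℝ, E) 𝓘(ℝ, E') ∞ φ
  isometric : ∀ (p : M) (u v : TangentSpace 𝓘(ℝ, E) p),
    (inner ℝ (mfderiv 𝓘(ℝ, E) 𝓘(ℝ, E') φ p u) (mfderiv 𝓘(ℝ, E) 𝓘(ℝ, E') φ p v) : ℝ)
      = inner ℝ u v

variable (E E') in
/-- The map `φ` in the charts around `p` and `φ p`. -/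
def coordMap (φ : M → M') (p : M) (x : E) : E' :=
  extChartAt 𝓘(ℝ, E') (φ p) (φ ((extChartAt 𝓘(ℝ, E) p).symm x))

variable (E E') in
/-- The second fundamental form, given by the Gauss formula `σ(X, Y) = ∇'_X Y - ∇_X Y`, where `∇'`
and `∇` are the Levi-Civita connections of the ambient manifold and of the submanifold. In
coordinates `∇'_u (dφ v) = D²φ(u, v) + Γ'(dφ u, dφ v)` and `dφ (∇_u v) = dφ (Γ(u, v))`, for
constant `u` and `v`. -/
def sff (φ : M → M') (p : M) (u v : TangentSpace 𝓘(ℝ, E) p) : TangentSpace 𝓘(ℝ, E') (φ p) :=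
  let x : E := extChartAt 𝓘(ℝ, E) p p
  let Φ : E → E' := coordMap E E' φ p
  let a : E := u
  let b : E := v
  let s : E' := fderiv ℝ (fderiv ℝ Φ) x a b
    + christoffel (coordMetric (φ p)) (Φ x) (fderiv ℝ Φ x a) (fderiv ℝ Φ x b)
    - fderiv ℝ Φ x (christoffel (coordMetric p) x a b)
  s

variable [FiniteDimensional ℝ E]

variable (E E') in
/-- The mean curvature vector `H = (1 / dim M) ∑ᵢ σ(eᵢ, eᵢ)`. -/
def meanCurvature (φ : M → M') (p : M) : TangentSpace 𝓘(ℝ, E') (φ p) :=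
  (1 / (Module.finrank ℝ E : ℝ)) • ∑ i, sff E E' φ p (orthoBasis E p i) (orthoBasis E p i)

variable (E E') in
/-- The component of an ambient vector that is tangent to the submanifold. -/
def tangentialPart (φ : M → M') (p : M) (w : TangentSpace 𝓘(ℝ, E') (φ p)) :
    TangentSpace 𝓘(ℝ, E') (φ p) :=
  (LinearMap.range (mfderiv 𝓘(ℝ, E) 𝓘(ℝ, E') φ p).toLinearMap).starProjection w

variable (E E') in
/-- Totally geodesic: the second fundamental form vanishes. -/
def IsTotallyGeodesic (φ : M → M') : Prop :=
  ∀ (p : M) (u v : TangentSpace 𝓘(ℝ, E) p), sff E E' φ p u v = 0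

end Immersed

/-! ### Metric f-manifolds -/

section MetricF

open LocalRiemann RiemannChart Immersed

variable (E : Type*) [NormedAddCommGroup E] [NormedSpace ℝ E]
  (M : Type*) [TopologicalSpace M] [ChartedSpace E M] [IsManifold 𝓘(ℝ, E) ∞ M]
  [RiemannianBundle (fun q : M ↦ TangentSpace 𝓘(ℝ, E) q)]

/-- A metric f-structure with `s` structure vector fields `ξ α` and dual 1-forms `η α`. (The
identity `f³ + f = 0` follows from `f_ξ` and `f_sq`, and the kernel of `f` is spanned by the `ξ α`,
so that on a manifold of dimension `2m + s` the rank of `f` is `2m`.) -/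
structure MetricFStructure (s : ℕ) where
  f : ∀ q : M, TangentSpace 𝓘(ℝ, E) q →L[ℝ] TangentSpace 𝓘(ℝ, E) q
  ξ : Fin s → ∀ q : M, TangentSpace 𝓘(ℝ, E) q
  η : Fin s → ∀ q : M, TangentSpace 𝓘(ℝ, E) q →L[ℝ] ℝ
  smooth_f : ContMDiff 𝓘(ℝ, E) (𝓘(ℝ, E).prod 𝓘(ℝ, E →L[ℝ] E)) ∞
    (fun q ↦ Bundle.TotalSpace.mk' (E →L[ℝ] E)
      (E := fun q : M ↦ TangentSpace 𝓘(ℝ, E) q →L[ℝ] TangentSpace 𝓘(ℝ, E) q) q (f q))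
  smooth_ξ : ∀ α, ContMDiff 𝓘(ℝ, E) 𝓘(ℝ, E).tangent ∞
    (fun q ↦ (⟨q, ξ α q⟩ : TangentBundle 𝓘(ℝ, E) M))
  smooth_η : ∀ α, ContMDiff 𝓘(ℝ, E) (𝓘(ℝ, E).prod 𝓘(ℝ, E →L[ℝ] ℝ)) ∞
    (fun q ↦ Bundle.TotalSpace.mk' (E →L[ℝ] ℝ)
      (E := fun q : M ↦ TangentSpace 𝓘(ℝ, E) q →L[ℝ] ℝ) q (η α q))
  η_ξ : ∀ α β q, η α q (ξ β q) = if α = β then 1 else 0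
  f_ξ : ∀ α q, f q (ξ α q) = 0
  η_f : ∀ α q X, η α q (f q X) = 0
  f_sq : ∀ q X, f q (f q X) = -X + ∑ α, η α q X • ξ α q
  metric : ∀ (q : M) (X Y : TangentSpace 𝓘(ℝ, E) q),
    (inner ℝ X Y : ℝ) = inner ℝ (f q X) (f q Y) + ∑ α, η α q X * η α q Y

namespace MetricFStructure

variable {E M} {s : ℕ} (S : MetricFStructure E M s)

/-- The fundamental 2-form `F(X, Y) = g(X, f Y)`, in the chart around `p`. -/
def coordFundamental (p : M) (y : E) : E →L[ℝ] E →L[ℝ] ℝ :=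
  (coordMetric p y).bilinearComp (ContinuousLinearMap.id ℝ E) (coordEndo S.f p y)

/-- Normality `[f, f] + 2 ∑ ξ_α ⊗ dη_α = 0`, checked at every point of every chart. -/
def IsNormal : Prop :=
  ∀ p : M, ∀ y ∈ (extChartAt 𝓘(ℝ, E) p).target, ∀ u v : E,
    nijenhuis (coordEndo S.f p) y u v
      + (2 : ℝ) • ∑ α, dOneForm (coordForm (S.η α) p) y u v • coordField (S.ξ α) p y = 0

/-- A `K`-manifold is normal with `dF = 0`. -/
structure IsKManifold : Prop where
  normal : S.IsNormal
  closed : ∀ p : M, ∀ y ∈ (extChartAt 𝓘(ℝ, E) p).target, ∀ u v w : E,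
    dTwoForm (S.coordFundamental p) y u v w = 0

/-- A `C`-manifold is a `K`-manifold with `dη_α = 0` for all `α`. -/
structure IsCManifold : Prop where
  isK : S.IsKManifold
  closed_η : ∀ α, ∀ p : M, ∀ y ∈ (extChartAt 𝓘(ℝ, E) p).target, ∀ u v : E,
    dOneForm (coordForm (S.η α) p) y u v = 0

section SpaceForm

variable (S : MetricFStructure E M 2)

def R₁ (q : M) (X Y Z : TangentSpace 𝓘(ℝ, E) q) : TangentSpace 𝓘(ℝ, E) q :=
  (inner ℝ Y Z : ℝ) • X - (inner ℝ X Z : ℝ) • Y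

def R₂ (q : M) (X Y Z : TangentSpace 𝓘(ℝ, E) q) : TangentSpace 𝓘(ℝ, E) q :=
  (inner ℝ X (S.f q Z) : ℝ) • S.f q Y - (inner ℝ Y (S.f q Z) : ℝ) • S.f q X
    + (2 * inner ℝ X (S.f q Y) : ℝ) • S.f q Z

def R₃ (q : M) (X Y Z : TangentSpace 𝓘(ℝ, E) q) : TangentSpace 𝓘(ℝ, E) q :=
  (S.η 0 q X * S.η 1 q Y * S.η 1 q Z) • S.ξ 0 q - (S.η 1 q X * S.η 0 q Y * S.η 1 q Z) • S.ξ 0 q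
    + (S.η 1 q X * S.η 0 q Y * S.η 0 q Z) • S.ξ 1 q
    - (S.η 0 q X * S.η 1 q Y * S.η 0 q Z) • S.ξ 1 q

def Rη (i j : Fin 2) (q : M) (X Y Z : TangentSpace 𝓘(ℝ, E) q) : TangentSpace 𝓘(ℝ, E) q :=
  (S.η i q X * S.η j q Z) • Y - (S.η i q Y * S.η j q Z) • X
    + ((inner ℝ X Z : ℝ) * S.η i q Y) • S.ξ j q - ((inner ℝ Y Z : ℝ) * S.η i q X) • S.ξ j q

/-- The manifold is a generalized `S`-space-form with the seven coefficient functions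
`F₁, F₂, F₃` and `Fη i j`. -/
structure IsGeneralizedSSpaceForm (F₁ F₂ F₃ : M → ℝ) (Fη : Fin 2 → Fin 2 → M → ℝ) : Prop where
  smooth₁ : ContMDiff 𝓘(ℝ, E) 𝓘(ℝ, ℝ) ∞ F₁
  smooth₂ : ContMDiff 𝓘(ℝ, E) 𝓘(ℝ, ℝ) ∞ F₂
  smooth₃ : ContMDiff 𝓘(ℝ, E) 𝓘(ℝ, ℝ) ∞ F₃
  smooth_η : ∀ i j, ContMDiff 𝓘(ℝ, E) 𝓘(ℝ, ℝ) ∞ (Fη i j)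
  curvature_eq : ∀ (q : M) (X Y Z : TangentSpace 𝓘(ℝ, E) q),
    riemann q X Y Z = F₁ q • R₁ q X Y Z + F₂ q • S.R₂ q X Y Z + F₃ q • S.R₃ q X Y Z
      + ∑ i, ∑ j, Fη i j q • S.Rη i j q X Y Z

end SpaceForm

section Submanifold

variable {N : Type*} {EN : Type*} [NormedAddCommGroup EN] [NormedSpace ℝ EN]
  [TopologicalSpace N] [ChartedSpace EN N]

variable (EN) in
/-- All the structure vector fields are tangent to the submanifold `φ : N → M`. -/
def IsTangentTo (φ : N → M) : Prop :=
  ∀ (α : Fin s) (p : N), ∃ u : TangentSpace 𝓘(ℝ, EN) p,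
    mfderiv 𝓘(ℝ, EN) 𝓘(ℝ, E) φ p u = S.ξ α (φ p)

variable (EN) in
/-- The vectors tangent to the submanifold and orthogonal to all the structure vector fields: the
distribution `𝓛`. -/
def distL (φ : N → M) (p : N) : Set (TangentSpace 𝓘(ℝ, EN) p) :=
  {u | ∀ α, (inner ℝ (mfderiv 𝓘(ℝ, EN) 𝓘(ℝ, E) φ p u) (S.ξ α (φ p)) : ℝ) = 0}

variable [RiemannianBundle (fun q : N ↦ TangentSpace 𝓘(ℝ, EN) q)]

variable (EN) in
/-- Totally f-umbilical: `σ(X, Y) = g(X, Y) V` on `𝓛` for some normal vector field `V`. (When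
`𝓛 ≠ 0` the field `V` is unique, locally `V = σ(X, X)` for a unit field `X` in `𝓛`, so it is
automatically smooth.) -/
def IsTotallyFUmbilical (φ : N → M) : Prop :=
  ∃ V : ∀ p : N, TangentSpace 𝓘(ℝ, E) (φ p),
    (∀ (p : N) (u : TangentSpace 𝓘(ℝ, EN) p),
      (inner ℝ (V p) (mfderiv 𝓘(ℝ, EN) 𝓘(ℝ, E) φ p u) : ℝ) = 0) ∧
    ∀ p : N, ∀ u ∈ S.distL EN φ p, ∀ v ∈ S.distL EN φ p, sff EN E φ p u v = (inner ℝ u v : ℝ) • V p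

variable [FiniteDimensional ℝ EN]

variable (EN) in
/-- `T U`, the tangential component of `f U`. -/
def tanF (φ : N → M) (p : N) (u : TangentSpace 𝓘(ℝ, EN) p) : TangentSpace 𝓘(ℝ, E) (φ p) :=
  tangentialPart EN E φ p (S.f (φ p) (mfderiv 𝓘(ℝ, EN) 𝓘(ℝ, E) φ p u))

end Submanifold

end MetricFStructure

end MetricF

end

/-! ### Derivatives of expressions built from bilinear and linear maps -/

section Calculus

variable {E F : Type*} [NormedAddCommGroup E] [NormedSpace ℝ E]
  [NormedAddCommGroup F] [NormedSpace ℝ F]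
  {F' : Type*} [NormedAddCommGroup F'] [NormedSpace ℝ F']
  {F'' : Type*} [NormedAddCommGroup F''] [NormedSpace ℝ F'']

/-! The geometric input is that on a `C`-manifold the tensors `f` and `ξ α` are parallel
(`parallel_of_normal_closed`). Two facts follow. The curvature kills each `ξ α` and commutes with
`f`, which pins down the coefficient functions. Moreover, the second fundamental form `σ` of a
submanifold tangent to the `ξ α` kills them, because the tangential and normal parts of the
derivative of `ξ α` vanish separately.

For the coefficients: `R(Y, ξ α) ξ α = 0` gives `Fη α α = F₁`. If the ambient dimension exceeds
four, comparing `R(X, Y) f Y` with `f R(X, Y) Y`, for `Y` orthogonal to `X`, `f X` and the `ξ α`,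
gives `F₁ = F₂`; in dimension four this is the normalization assumed. The ambient part of the Ricci
curvature of a unit `U` in `𝓛` is then `((n - 1) + 3 ‖TU‖²) F₁`.

By the Gauss equation the remaining part is `⟨h, σ(U, U)⟩ - ∑ ‖σ(eᵢ, U)‖²`, where `h = (n + 2) H` is
the trace of `σ`. Completing squares (`VectorForm.trace_sub_sq_eq`) writes it as `‖h‖² / 4` minus a
sum of squares. This is the inequality, and equality at `U` means `σ(v, U) = ⟨v, U⟩ h / 2` for all
`v`. Equality for all `U` in `𝓛` therefore says that `σ` is umbilical on `𝓛` with factor `h / 2`.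
Since `σ` kills the two structure directions, taking the trace gives `h = (n / 2) h`: either `n =
2`, or `h = 0` and so `σ = 0`.

Everything differential is proved for a metric on an open subset of a vector space, and then carried
to the manifolds through the preferred charts, whose frames are the identity at their base points.
-/

theorem fderiv_clm_apply_apply {f : E → F →L[ℝ] F'} {a : E → F} {y : E}
    (hf : DifferentiableAt ℝ f y) (ha : DifferentiableAt ℝ a y) (w : E) :
    fderiv ℝ (fun y ↦ f y (a y)) y w = fderiv ℝ f y w (a y) + f y (fderiv ℝ a y w) := by
  rw [fderiv_clm_apply hf ha]
  simp [add_comm]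

theorem fderiv_bilin_apply {G : E → F →L[ℝ] F' →L[ℝ] F''} {a : E → F} {b : E → F'} {y : E}
    (hG : DifferentiableAt ℝ G y) (ha : DifferentiableAt ℝ a y) (hb : DifferentiableAt ℝ b y)
    (w : E) :
    fderiv ℝ (fun y ↦ G y (a y) (b y)) y w
      = fderiv ℝ G y w (a y) (b y) + G y (fderiv ℝ a y w) (b y) + G y (a y) (fderiv ℝ b y w) := by
  rw [fderiv_clm_apply_apply (hG.clm_apply ha) hb, fderiv_clm_apply_apply hG ha]
  simp

end Calculus

/-! ### Levi-Civita connection in coordinates, and curvature acting on parallel tensors. -/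

namespace LocalRiemann

variable {E : Type*} [NormedAddCommGroup E] [NormedSpace ℝ E]

/-- A smooth nondegenerate metric on an open subset of a vector space. -/
structure IsMetricOn (G : E → E →L[ℝ] E →L[ℝ] ℝ) (U : Set E) : Prop where
  isOpen : IsOpen U
  smooth : ContDiffOn ℝ ∞ G U
  symm : ∀ y ∈ U, ∀ u v, G y u v = G y v u
  inv : ∀ y ∈ U, (G y).IsInvertible

namespace IsMetricOn

variable {G : E → E →L[ℝ] E →L[ℝ] ℝ} {U : Set E} {y : E}

theorem mem_nhds (hG : IsMetricOn G U) (hy : y ∈ U) : U ∈ nhds y := hG.isOpen.mem_nhds hy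

theorem differentiableAt (hG : IsMetricOn G U) (hy : y ∈ U) : DifferentiableAt ℝ G y :=
  (hG.smooth.contDiffAt (hG.mem_nhds hy)).differentiableAt (by simp)

theorem fderiv_symm (hG : IsMetricOn G U) (hy : y ∈ U) (w u v : E) :
    fderiv ℝ G y w u v = fderiv ℝ G y w v u := by
  have key : ∀ a b : E, fderiv ℝ (fun y ↦ G y a b) y w = fderiv ℝ G y w a b := by
    intro a b
    rw [fderiv_bilin_apply (hG.differentiableAt hy) (differentiableAt_const a)
      (differentiableAt_const b)]
    simp
  rw [← key, ← key]
  have : (fun y ↦ G y u v) =ᶠ[nhds y] (fun y ↦ G y v u) := by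
    filter_upwards [hG.mem_nhds hy] with z hz using hG.symm z hz u v
  rw [this.fderiv_eq]

theorem christoffel_left (hG : IsMetricOn G U) (hy : y ∈ U) (u v w : E) :
    G y (christoffel G y u v) w
      = (1 / 2) * (fderiv ℝ G y u v w + fderiv ℝ G y v u w - fderiv ℝ G y w u v) := by
  rw [christoffel_apply, (hG.inv y hy).self_apply_inverse, christoffelFirst_apply]

theorem eq_of_forall (hG : IsMetricOn G U) (hy : y ∈ U) {a b : E}
    (h : ∀ w, G y a w = G y b w) : a = b :=
  (hG.inv y hy).injective (ContinuousLinearMap.ext h)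

theorem christoffel_symm (hG : IsMetricOn G U) (hy : y ∈ U) (u v : E) :
    christoffel G y u v = christoffel G y v u := by
  refine hG.eq_of_forall hy fun w ↦ ?_
  rw [hG.christoffel_left hy, hG.christoffel_left hy, hG.fderiv_symm hy w u v]
  ring

/-- The Levi-Civita connection is compatible with the metric. -/
theorem fderiv_eq (hG : IsMetricOn G U) (hy : y ∈ U) (w u v : E) :
    fderiv ℝ G y w u v = G y (christoffel G y w u) v + G y u (christoffel G y w v) := by
  rw [hG.symm y hy u, hG.christoffel_left hy, hG.christoffel_left hy, hG.fderiv_symm hy w v u]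
  ring

theorem smooth_christoffel [CompleteSpace E] (hG : IsMetricOn G U) :
    ContDiffOn ℝ ∞ (christoffel G) U := by
  have hD : ContDiffOn ℝ ∞ (fderiv ℝ G) U := hG.smooth.fderiv_of_isOpen hG.isOpen (by simp)
  have hinv : ContDiffOn ℝ ∞ (fun y ↦ (G y).inverse) U := by
    intro y hy
    have h1 : ContDiffAt ℝ ∞ ContinuousLinearMap.inverse (G y) :=
      (hG.inv y hy).contDiffAt_map_inverse
    exact h1.comp_contDiffWithinAt y (hG.smooth y hy)
  have hflip : ContDiff ℝ ∞ (fun A : E →L[ℝ] E →L[ℝ] E →L[ℝ] ℝ ↦ A.flip) :=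
    (ContinuousLinearMap.flipₗᵢ ℝ E E (E →L[ℝ] ℝ)).contDiff
  have h1 : ContDiffOn ℝ ∞ (christoffelFirst G) U := by
    unfold christoffelFirst derivLast
    exact ((hD.add (hflip.comp_contDiffOn hD)).sub
      (contDiffOn_const.clm_comp (hflip.comp_contDiffOn hD))).const_smul (1 / 2 : ℝ)
  exact ((ContinuousLinearMap.contDiff
    (ContinuousLinearMap.compL ℝ E (E →L[ℝ] ℝ) E)).comp_contDiffOn hinv).clm_comp h1

theorem differentiableAt_christoffel [CompleteSpace E] (hG : IsMetricOn G U) (hy : y ∈ U) :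
    DifferentiableAt ℝ (christoffel G) y :=
  (hG.smooth_christoffel.contDiffAt (hG.mem_nhds hy)).differentiableAt (by simp)

/-- The derivative of the scalar product of two vector fields. -/
theorem fderiv_metric_apply (hG : IsMetricOn G U) (hy : y ∈ U) {a b : E → E}
    (ha : DifferentiableAt ℝ a y) (hb : DifferentiableAt ℝ b y) (w : E) :
    fderiv ℝ (fun y ↦ G y (a y) (b y)) y w
      = G y (fderiv ℝ a y w + christoffel G y w (a y)) (b y)
        + G y (a y) (fderiv ℝ b y w + christoffel G y w (b y)) := by
  rw [fderiv_bilin_apply (hG.differentiableAt hy) ha hb, hG.fderiv_eq hy]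
  simp only [map_add, add_apply]
  ring

/-- A parallel vector field is annihilated by the curvature. -/
theorem curvature_parallel_field [CompleteSpace E] (hG : IsMetricOn G U) (hy : y ∈ U) {ξ : E → E}
    (hξ : ContDiffOn ℝ ∞ ξ U)
    (par : ∀ z ∈ U, ∀ u, fderiv ℝ ξ z u + christoffel G z u (ξ z) = 0) (u v : E) :
    curvature G y u v (ξ y) = 0 := by
  have hξy : ContDiffAt ℝ ∞ ξ y := hξ.contDiffAt (hG.mem_nhds hy)
  have hd : DifferentiableAt ℝ ξ y := hξy.differentiableAt (by simp)
  have hd2 : DifferentiableAt ℝ (fderiv ℝ ξ) y :=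
    (hξy.fderiv_right (m := ∞) (by simp)).differentiableAt (by simp)
  have hΓ := hG.differentiableAt_christoffel hy
  have hsymm : IsSymmSndFDerivAt ℝ ξ y :=
    hξy.isSymmSndFDerivAt (by
      rw [minSmoothness_of_isRCLikeNormedField]; exact WithTop.coe_le_coe.2 le_top)
  -- This is the derivative along `a` of `∇_b ξ = 0`. Exchanging `a` and `b` and subtracting removes
  -- the second derivative of `ξ`; substituting `∂_a ξ = -Γ(a, ξ)` leaves the curvature.
  have key : ∀ a b : E, fderiv ℝ (fderiv ℝ ξ) y a b + (fderiv ℝ (christoffel G) y a b (ξ y)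
      + christoffel G y b (fderiv ℝ ξ y a)) = 0 := by
    intro a b
    have h0 : (fun z ↦ fderiv ℝ ξ z b + christoffel G z b (ξ z)) =ᶠ[nhds y] fun _ ↦ (0 : E) := by
      filter_upwards [hG.mem_nhds hy] with z hz using par z hz b
    have h1 := congrArg (fun A : E →L[ℝ] E ↦ A a) h0.fderiv_eq
    have h2 : DifferentiableAt ℝ (fun z ↦ fderiv ℝ ξ z b) y := hd2.clm_apply (by fun_prop)
    have h3 : DifferentiableAt ℝ (fun z ↦ christoffel G z b) y := hΓ.clm_apply (by fun_prop)
    rw [show (fun z ↦ fderiv ℝ ξ z b + christoffel G z b (ξ z)) =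
      (fun z ↦ fderiv ℝ ξ z b) + fun z ↦ christoffel G z b (ξ z) from rfl,
      fderiv_add h2 (h3.clm_apply hd)] at h1
    simp only [add_apply] at h1
    rw [fderiv_clm_apply_apply h3 hd, fderiv_clm_apply_apply hd2 (by fun_prop),
      fderiv_clm_apply_apply hΓ (by fun_prop)] at h1
    simpa using h1
  have e : ∀ a, fderiv ℝ ξ y a = - christoffel G y a (ξ y) := fun a ↦
    eq_neg_of_add_eq_zero_left (par y hy a)
  have k1 := key u v
  have k2 := key v u
  rw [e, map_neg] at k1 k2
  rw [hsymm.eq v u] at k2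
  have := sub_eq_zero.2 (k1.trans k2.symm)
  rw [curvature, ← this]
  abel

/-- The curvature commutes with a parallel field of endomorphisms. -/
theorem curvature_parallel_endo [CompleteSpace E] (hG : IsMetricOn G U) (hy : y ∈ U)
    {f : E → E →L[ℝ] E} (hf : ContDiffOn ℝ ∞ f U)
    (par : ∀ z ∈ U, ∀ u v,
      fderiv ℝ f z u v + christoffel G z u (f z v) - f z (christoffel G z u v) = 0) (u v w : E) :
    curvature G y u v (f y w) = f y (curvature G y u v w) := by
  have hfy : ContDiffAt ℝ ∞ f y := hf.contDiffAt (hG.mem_nhds hy)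
  have hd : DifferentiableAt ℝ f y := hfy.differentiableAt (by simp)
  have hd2 : DifferentiableAt ℝ (fderiv ℝ f) y :=
    (hfy.fderiv_right (m := ∞) (by simp)).differentiableAt (by simp)
  have hΓ := hG.differentiableAt_christoffel hy
  have hsymm : IsSymmSndFDerivAt ℝ f y :=
    hfy.isSymmSndFDerivAt (by
      rw [minSmoothness_of_isRCLikeNormedField]; exact WithTop.coe_le_coe.2 le_top)
  -- As for vector fields: differentiate `(∇_b f) w = 0` along `a`, antisymmetrize, and eliminate
  -- the first derivatives of `f`.
  have key : ∀ a b : E, fderiv ℝ (fderiv ℝ f) y a b w + (fderiv ℝ (christoffel G) y a b (f y w)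
      + christoffel G y b (fderiv ℝ f y a w)) - (fderiv ℝ f y a (christoffel G y b w)
      + f y (fderiv ℝ (christoffel G) y a b w)) = 0 := by
    intro a b
    have h0 : (fun z ↦ fderiv ℝ f z b w + christoffel G z b (f z w) - f z (christoffel G z b w))
        =ᶠ[nhds y] fun _ ↦ (0 : E) := by
      filter_upwards [hG.mem_nhds hy] with z hz using par z hz b w
    have h1 := congrArg (fun A : E →L[ℝ] E ↦ A a) h0.fderiv_eq
    have h2 : DifferentiableAt ℝ (fun z ↦ fderiv ℝ f z b) y := hd2.clm_apply (by fun_prop)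
    have h3 : DifferentiableAt ℝ (fun z ↦ christoffel G z b) y := hΓ.clm_apply (by fun_prop)
    have h4 : DifferentiableAt ℝ (fun z ↦ f z w) y := hd.clm_apply (by fun_prop)
    have h5 : DifferentiableAt ℝ (fun z ↦ christoffel G z b w) y := h3.clm_apply (by fun_prop)
    have h6 : DifferentiableAt ℝ (fun z ↦ fderiv ℝ f z b w) y := h2.clm_apply (by fun_prop)
    rw [show (fun z ↦ fderiv ℝ f z b w + christoffel G z b (f z w) - f z (christoffel G z b w)) =
      (fun z ↦ fderiv ℝ f z b w) + (fun z ↦ christoffel G z b (f z w))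
        - (fun z ↦ f z (christoffel G z b w)) from rfl,
      fderiv_sub (h6.add (h3.clm_apply h4)) (hd.clm_apply h5), fderiv_add h6 (h3.clm_apply h4)]
      at h1
    simp only [add_apply, sub_apply] at h1
    rw [fderiv_clm_apply_apply h3 h4, fderiv_clm_apply_apply hd h5,
      fderiv_clm_apply_apply h2 (by fun_prop), fderiv_clm_apply_apply hd2 (by fun_prop),
      fderiv_clm_apply_apply h3 (by fun_prop), fderiv_clm_apply_apply hd (by fun_prop),
      fderiv_clm_apply_apply hΓ (by fun_prop)] at h1
    simpa using h1
  have e : ∀ a b, fderiv ℝ f y a b = f y (christoffel G y a b) - christoffel G y a (f y b) := by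
    intro a b
    rw [← sub_eq_zero, ← par y hy a b]
    abel
  have k1 := key u v
  have k2 := key v u
  rw [e, e, map_sub] at k1 k2
  rw [hsymm.eq v u] at k2
  have := sub_eq_zero.2 (k1.trans k2.symm)
  rw [curvature, curvature, ← sub_eq_zero, ← this]
  simp only [map_sub, map_add]
  abel

end IsMetricOn

end LocalRiemann

/-! ### The structure tensors of a `C`-manifold are parallel. -/

namespace LocalRiemann

variable {E : Type*} [NormedAddCommGroup E] [NormedSpace ℝ E]

/-- The covariant derivatives `B` of the structure fields and `A` of `f` of a metric f-structure
vanish if they satisfy the pointwise identities that express normality, `dF = 0` and `dη = 0`. -/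
theorem parallel_of_normal_closed {ι : Type*} [Fintype ι] [DecidableEq ι]
    (g : E →L[ℝ] E →L[ℝ] ℝ) (f : E →L[ℝ] E) (ξ : ι → E) (A : E →L[ℝ] E →L[ℝ] E)
    (B : ι → E →L[ℝ] E)
    (gs : ∀ u v, g u v = g v u) (gn : ∀ u, (∀ w, g u w = 0) → u = 0)
    (fξ : ∀ α, f (ξ α) = 0)
    (ff : ∀ v, f (f v) = -v + ∑ α, g (ξ α) v • ξ α)
    (fs : ∀ u v, g (f u) v = - g u (f v))
    (A_skew : ∀ X Y Z, g (A X Y) Z = - g Y (A X Z))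
    (A_ξ : ∀ α X, A X (ξ α) + f (B α X) = 0)
    (B_symm : ∀ α X Y, g (B α X) Y = g (B α Y) X)
    (B_ξ : ∀ α β X, g (B α X) (ξ β) + g (ξ α) (B β X) = 0)
    (A_f : ∀ X Y, A X (f Y) + f (A X Y)
      = ∑ α, (g (B α X) Y • ξ α + g (ξ α) Y • B α X))
    (cyc : ∀ X Y Z, g X (A Z Y) + g Y (A X Z) + g Z (A Y X) = 0)
    (N : ∀ X Y, A (f X) Y - A (f Y) X + f (A Y X) - f (A X Y) = 0) :
    (∀ α, B α = 0) ∧ A = 0 := by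
  have Aξ : ∀ α X, A X (ξ α) = - f (B α X) := fun α X ↦ eq_neg_of_add_eq_zero_left (A_ξ α X)
  -- An array antisymmetric in one pair of indices (orthonormality of the `ξ`) and symmetric in an
  -- overlapping pair (`dη = 0`) vanishes.
  have b0 : ∀ α β γ, g (ξ β) (B α (ξ γ)) = 0 := by
    intro α β γ
    have anti : ∀ α β γ, g (ξ β) (B α (ξ γ)) = - g (ξ α) (B β (ξ γ)) := by
      intro α β γ
      have := B_ξ α β (ξ γ)
      rw [gs (ξ β)]
      linarith
    have sym : ∀ α β γ, g (ξ β) (B α (ξ γ)) = g (ξ γ) (B α (ξ β)) := by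
      intro α β γ
      rw [gs (ξ β), B_symm, gs]
    linarith [anti α β γ, sym β α γ, anti β γ α, sym γ β α, anti γ α β, sym α γ β]
  have ffB : ∀ α β, f (f (B α (ξ β))) = - B α (ξ β) := by
    intro α β
    rw [ff]
    simp [b0]
  -- Normality on a pair of structure fields gives `B α (ξ β) = B β (ξ α)`, that is, the fields
  -- commute. Pairing with `X`, the symmetry of `B` and `B_ξ` also make these two vectors opposite.
  have Bξ : ∀ α β, B α (ξ β) = 0 := by
    intro α β
    have h := N (ξ α) (ξ β)
    have h1 : B α (ξ β) = B β (ξ α) := by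
      simp only [fξ, Aξ, map_neg, ffB, map_zero, neg_neg] at h
      simpa [sub_eq_zero, ← sub_eq_add_neg] using h
    refine gn _ fun X ↦ ?_
    have h2 := B_ξ α β X
    rw [B_symm α, gs (ξ α), B_symm β, ← h1] at h2
    linarith
  have ξB : ∀ α β X, g (ξ β) (B α X) = 0 := by
    intro α β X
    rw [gs, B_symm, Bξ]
    simp
  -- Off the span of the `ξ`, `f` behaves as an orthogonal complex structure.
  have gff : ∀ a Y, (∀ β, g (ξ β) a = 0) → g (f a) (f Y) = g a Y := by
    intro a Y h
    have := fs (f a) Y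
    rw [ff] at this
    simp only [h, zero_smul, Finset.sum_const_zero, add_zero, map_neg, neg_apply] at this
    linarith
  have hB : ∀ α, B α = 0 := by
    intro α
    -- Normality on `(X, ξ α)` paired with `f Y`, and `dF(X, Y, ξ α) = 0`, both express `g(A (ξ α)
    -- X, Y)` through `B α`. Eliminating it and using the symmetry of `B α` leaves `2 g(B α Y, f X)
    -- = 0`. Replacing `X` by `f W` then suffices, since `B α Y` is orthogonal to the `ξ`.
    have key : ∀ X Y, g (B α Y) (f X) = 0 := by
      intro X Y
      have h := congrArg (fun v ↦ g v (f Y)) (N X (ξ α))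
      have hA : ∀ β, g (ξ β) (A (ξ α) X) = 0 := by
        intro β
        have := A_skew (ξ α) (ξ β) X
        rw [Aξ, Bξ] at this
        simp only [map_zero, neg_zero, zero_apply] at this
        linarith
      have hff : f (f (B α X)) = - B α X := by
        rw [ff]
        simp [ξB]
      rw [Aξ, fξ, Aξ, map_neg, hff] at h
      simp only [map_zero, map_sub, map_add, map_neg, zero_apply, add_apply, sub_apply,
        neg_apply] at h
      rw [gff _ _ (fun β ↦ ξB α β (f X)), gff _ _ hA] at h
      have c := cyc X Y (ξ α)
      rw [Aξ, map_neg, gs Y, fs, gs (ξ α), A_skew Y X, Aξ, map_neg, gs X (f _), fs] at c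
      have s := A_skew (ξ α) X Y
      have b := B_symm α (f X) Y
      linarith
    ext Y
    refine gn _ fun W ↦ ?_
    have := key (f W) Y
    rw [ff] at this
    simp only [map_add, map_neg, map_sum, map_smul, gs _ (ξ _), ξB, smul_zero,
      Finset.sum_const_zero, add_zero] at this
    linarith
  refine ⟨hB, ?_⟩
  have hAξ : ∀ α X, A X (ξ α) = 0 := by
    intro α X
    rw [Aξ, hB]
    simp
  have hAf : ∀ X Y, A X (f Y) = - f (A X Y) := by
    intro X Y
    refine eq_neg_of_add_eq_zero_left ((A_f X Y).trans ?_)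
    simp [hB]
  have move : ∀ X Y Z, g (A X (f Y)) Z = g (A X Y) (f Z) := by
    intro X Y Z
    rw [hAf]
    simp [fs]
  -- With `B = 0`, `A X` is skew and anticommutes with `f`, as for an almost Hermitian structure.
  -- The argument is the one showing that a complex structure with closed fundamental form is
  -- Kähler: `dF` on `(f X, Y, Z)` and `(X, f Y, Z)` is combined with the Nijenhuis identity paired
  -- with `Z`.
  have key : ∀ X Y Z, g (A Z X) (f Y) = 0 := by
    intro X Y Z
    have n := congrArg (fun v ↦ g v Z) (N X Y)
    simp only [map_zero, map_sub, map_add, zero_apply, add_apply, sub_apply, fs] at n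
    have sk := A_skew
    have c1 := cyc (f X) Y Z
    have c2 := cyc X (f Y) Z
    have e : ∀ X Y Z, g X (A Y Z) = g (A Y Z) X := fun X Y Z ↦ gs _ _
    simp only [e] at sk c1 c2
    linarith [sk (f X) Y Z, sk (f Y) X Z, sk Y X (f Z), sk X Y (f Z), sk Z Y (f X), sk Z X (f Y),
      move Z X Y, move Z Y X, move X Y Z, move Y X Z, sk X (f Y) Z, sk Y (f X) Z, sk X Z (f Y),
      move X Z Y, move Y Z X, sk Y Z (f X), sk (f Y) Z X]
  ext Z X
  refine gn _ fun W ↦ ?_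
  have := key X (f W) Z
  rw [ff] at this
  have h0 : ∀ α, g (A Z X) (ξ α) = 0 := by
    intro α
    rw [A_skew, hAξ]
    simp
  simp only [map_add, map_neg, map_sum, map_smul, h0, smul_zero,
    Finset.sum_const_zero, add_zero] at this
  linarith

/-- The covariant derivative of a vector field. -/
noncomputable def covField (G : E → E →L[ℝ] E →L[ℝ] ℝ) (ξ : E → E) (y : E) : E →L[ℝ] E :=
  fderiv ℝ ξ y + (christoffel G y).flip (ξ y)

theorem covField_apply (G : E → E →L[ℝ] E →L[ℝ] ℝ) (ξ : E → E) (y u : E) :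
    covField G ξ y u = fderiv ℝ ξ y u + christoffel G y u (ξ y) := rfl

/-- The covariant derivative of a field of endomorphisms. -/
noncomputable def covEndo (G : E → E →L[ℝ] E →L[ℝ] ℝ) (f : E → E →L[ℝ] E) (y : E) :
    E →L[ℝ] E →L[ℝ] E :=
  fderiv ℝ f y + (ContinuousLinearMap.compL ℝ E E E).flip (f y) ∘L christoffel G y
    - ContinuousLinearMap.compL ℝ E E E (f y) ∘L christoffel G y

theorem covEndo_apply (G : E → E →L[ℝ] E →L[ℝ] ℝ) (f : E → E →L[ℝ] E) (y u v : E) :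
    covEndo G f y u v
      = fderiv ℝ f y u v + christoffel G y u (f y v) - f y (christoffel G y u v) := rfl

/-- A metric f-structure in coordinates. -/
structure IsMetricFOn {ι : Type*} [Fintype ι] [DecidableEq ι] (G : E → E →L[ℝ] E →L[ℝ] ℝ)
    (f : E → E →L[ℝ] E) (ξ : ι → E → E) (U : Set E) : Prop extends IsMetricOn G U where
  smooth_f : ContDiffOn ℝ ∞ f U
  smooth_ξ : ∀ α, ContDiffOn ℝ ∞ (ξ α) U
  metric_ξ : ∀ y ∈ U, ∀ α β, G y (ξ α y) (ξ β y) = if α = β then 1 else 0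
  f_ξ : ∀ y ∈ U, ∀ α, f y (ξ α y) = 0
  f_sq : ∀ y ∈ U, ∀ v, f y (f y v) = -v + ∑ α, G y (ξ α y) v • ξ α y
  f_skew : ∀ y ∈ U, ∀ u v, G y (f y u) v = - G y u (f y v)

namespace IsMetricFOn

variable {ι : Type*} [Fintype ι] [DecidableEq ι] {G : E → E →L[ℝ] E →L[ℝ] ℝ}
    {f : E → E →L[ℝ] E} {ξ : ι → E → E} {U : Set E} {y : E}

/-- The structure tensors of a `C`-manifold are parallel. -/
theorem parallel (h : IsMetricFOn G f ξ U) (hy : y ∈ U)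
    (normal : ∀ u v, nijenhuis f y u v = 0)
    (closed : ∀ u v w, dTwoForm
      (fun y ↦ (G y).bilinearComp (ContinuousLinearMap.id ℝ E) (f y)) y u v w = 0)
    (closed_ξ : ∀ α u v, dOneForm (fun y ↦ G y (ξ α y)) y u v = 0) :
    (∀ α, covField G (ξ α) y = 0) ∧ covEndo G f y = 0 := by
  have hG := h.toIsMetricOn
  have hU := hG.mem_nhds hy
  have df : DifferentiableAt ℝ f y := (h.smooth_f.contDiffAt hU).differentiableAt (by simp)
  have dξ : ∀ α, DifferentiableAt ℝ (ξ α) y := fun α ↦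
    ((h.smooth_ξ α).contDiffAt hU).differentiableAt (by simp)
  have dfc : ∀ v : E, DifferentiableAt ℝ (fun z ↦ f z v) y := fun v ↦
    df.clm_apply (differentiableAt_const v)
  have ef : ∀ u v, fderiv ℝ f y u v
      = covEndo G f y u v - christoffel G y u (f y v) + f y (christoffel G y u v) := by
    intro u v
    rw [covEndo_apply]
    abel
  have dfv : ∀ u v, fderiv ℝ (fun z ↦ f z v) y u = fderiv ℝ f y u v := by
    intro u v
    rw [fderiv_clm_apply_apply df (differentiableAt_const v)]
    simp
  -- The first five goals come from differentiating, in order, the skewness of `f`, `f ξ = 0`, the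
  -- 1-forms dual to `ξ`, `G(ξ, ξ) = δ` and the formula for `f²`; the last two rewrite `dF` and `[f,
  -- f]`. Ordinary derivatives become covariant ones, and the Christoffel terms cancel by the same
  -- identities and by the symmetry of `christoffel`.
  refine parallel_of_normal_closed (G y) (f y) (fun α ↦ ξ α y) (covEndo G f y)
    (fun α ↦ covField G (ξ α) y) (hG.symm y hy) (fun u hu ↦ hG.eq_of_forall hy (by simpa using hu))
    (h.f_ξ y hy) (h.f_sq y hy) (h.f_skew y hy) ?_ ?_ ?_ ?_ ?_ ?_ ?_
  · intro X Y Z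
    have e : (fun z ↦ G z (f z Y) Z) =ᶠ[nhds y] fun z ↦ - G z Y (f z Z) := by
      filter_upwards [hU] with z hz using h.f_skew z hz Y Z
    have e1 := congrArg (fun A : E →L[ℝ] ℝ ↦ A X) e.fderiv_eq
    simp only [fderiv_fun_neg, neg_apply] at e1
    rw [hG.fderiv_metric_apply hy (dfc Y) (differentiableAt_const Z),
      hG.fderiv_metric_apply hy (differentiableAt_const Y) (dfc Z), dfv, dfv] at e1
    have s1 := h.f_skew y hy (christoffel G y X Y) Z
    have s2 := h.f_skew y hy Y (christoffel G y X Z)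
    simp only [fderiv_fun_const, Pi.zero_apply, zero_apply, zero_add] at e1
    simp only [map_add, add_apply, map_sub, sub_apply, covEndo_apply] at e1 ⊢
    linarith
  · intro α X
    have e : (fun z ↦ f z (ξ α z)) =ᶠ[nhds y] fun z ↦ 0 := by
      filter_upwards [hU] with z hz using h.f_ξ z hz α
    have e1 := congrArg (fun A : E →L[ℝ] E ↦ A X) e.fderiv_eq
    rw [fderiv_clm_apply_apply df (dξ α)] at e1
    simp only [fderiv_fun_const, Pi.zero_apply, zero_apply] at e1
    rw [covEndo_apply, covField_apply, h.f_ξ y hy, map_add, map_zero, add_zero, ← e1]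
    abel
  · intro α X Y
    have e : ∀ u v, fderiv ℝ (fun z ↦ G z (ξ α z)) y u v
        = G y (covField G (ξ α) y u) v + G y (ξ α y) (christoffel G y u v) := by
      intro u v
      have := fderiv_clm_apply_apply (f := fun z ↦ G z (ξ α z)) (a := fun _ ↦ v) (y := y)
        ((hG.differentiableAt hy).clm_apply (dξ α)) (differentiableAt_const v) u
      rw [hG.fderiv_metric_apply hy (dξ α) (differentiableAt_const v)] at this
      simp only [fderiv_fun_const, Pi.zero_apply, zero_apply, zero_add, map_zero, add_zero] at this
      rw [← this, covField_apply]
    have c := closed_ξ α X Y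
    rw [dOneForm, e, e, hG.christoffel_symm hy Y X] at c
    linarith
  · intro α β X
    have e : (fun z ↦ G z (ξ α z) (ξ β z)) =ᶠ[nhds y] fun z ↦ if α = β then 1 else 0 := by
      filter_upwards [hU] with z hz using h.metric_ξ z hz α β
    have e1 := congrArg (fun A : E →L[ℝ] ℝ ↦ A X) e.fderiv_eq
    rw [hG.fderiv_metric_apply hy (dξ α) (dξ β)] at e1
    simpa [covField_apply] using e1
  · intro X Y
    have e : (fun z ↦ f z (f z Y)) =ᶠ[nhds y] fun z ↦ -Y + ∑ α, G z (ξ α z) Y • ξ α z := by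
      filter_upwards [hU] with z hz using h.f_sq z hz Y
    have e1 := congrArg (fun A : E →L[ℝ] E ↦ A X) e.fderiv_eq
    have dg : ∀ α, DifferentiableAt ℝ (fun z ↦ G z (ξ α z) Y) y := fun α ↦
      ((hG.differentiableAt hy).clm_apply (dξ α)).clm_apply (differentiableAt_const Y)
    rw [fderiv_clm_apply_apply df (dfc Y), dfv, fderiv_const_add,
      fderiv_fun_sum (fun α _ ↦ (dg α).fun_smul (dξ α))] at e1
    have e2 : ∀ α, fderiv ℝ (fun z ↦ G z (ξ α z) Y • ξ α z) y X
        = (G y (covField G (ξ α) y X) Y + G y (ξ α y) (christoffel G y X Y)) • ξ α y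
          + G y (ξ α y) Y • (covField G (ξ α) y X - christoffel G y X (ξ α y)) := by
      intro α
      rw [fderiv_fun_smul (dg α) (dξ α)]
      simp only [add_apply, smul_apply, ContinuousLinearMap.smulRight_apply]
      rw [hG.fderiv_metric_apply hy (dξ α) (differentiableAt_const Y), covField_apply]
      simp only [fderiv_fun_const, Pi.zero_apply, zero_apply, zero_add, add_sub_cancel_right]
      abel
    rw [sum_apply, Finset.sum_congr rfl (fun α _ ↦ e2 α)] at e1
    have q1 := h.f_sq y hy (christoffel G y X Y)
    have q2 := congrArg (christoffel G y X) (h.f_sq y hy Y)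
    simp only [map_add, map_neg, map_sum, map_smul] at q2
    simp only [add_smul, smul_sub, Finset.sum_add_distrib, Finset.sum_sub_distrib] at e1 ⊢
    rw [covEndo_apply, covEndo_apply, map_sub, map_add, q1, q2]
    rw [← sub_eq_zero] at e1 ⊢
    rw [← e1]
    abel
  · intro X Y Z
    have dF : DifferentiableAt ℝ
        (fun y ↦ (G y).bilinearComp (ContinuousLinearMap.id ℝ E) (f y)) y := by
      have : (fun y ↦ (G y).bilinearComp (ContinuousLinearMap.id ℝ E) (f y))
          = fun y ↦ (ContinuousLinearMap.compL ℝ E E ℝ).flip (f y) ∘L G y := by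
        ext; rfl
      rw [this]
      exact ((ContinuousLinearMap.differentiableAt _).comp y df).clm_comp (hG.differentiableAt hy)
    have e : ∀ w u v, fderiv ℝ
        (fun y ↦ (G y).bilinearComp (ContinuousLinearMap.id ℝ E) (f y)) y w u v
        = G y u (covEndo G f y w v) + G y u (f y (christoffel G y w v))
          + G y (christoffel G y w u) (f y v) := by
      intro w u v
      have := fderiv_bilin_apply dF (differentiableAt_const u) (differentiableAt_const v) w
      simp only [ContinuousLinearMap.bilinearComp_apply, ContinuousLinearMap.id_apply,
        fderiv_fun_const, Pi.zero_apply, zero_apply, map_zero, add_zero] at this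
      rw [hG.fderiv_metric_apply hy (differentiableAt_const u) (dfc v), dfv, ef] at this
      rw [← this]
      simp
      ring
    have c := closed X Y Z
    rw [dTwoForm, e, e, e] at c
    have s1 := h.f_skew y hy (christoffel G y X Y) Z
    have s2 := h.f_skew y hy (christoffel G y Y Z) X
    have s3 := h.f_skew y hy (christoffel G y Z X) Y
    rw [hG.christoffel_symm hy Y X, hG.christoffel_symm hy Z Y, hG.christoffel_symm hy X Z] at c
    have s := hG.symm y hy
    rw [s] at s1 s2 s3
    linarith
  · intro X Y
    have c := normal X Y
    rw [nijenhuis] at c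
    simp only [ef, map_add, map_sub] at c
    rw [hG.christoffel_symm hy (f y Y) (f y X), hG.christoffel_symm hy (f y X) Y,
      hG.christoffel_symm hy (f y Y) X, hG.christoffel_symm hy X Y] at c
    rw [← c]
    abel

end IsMetricFOn

end LocalRiemann

/-! ### Isometric immersions in coordinates and the Gauss equation. -/

namespace LocalRiemann

variable {E : Type*} [NormedAddCommGroup E] [NormedSpace ℝ E]
  {E' : Type*} [NormedAddCommGroup E'] [NormedSpace ℝ E']

/-- The ambient covariant derivative of the coordinate fields of an immersion. -/
noncomputable def ambientHessian (G' : E' → E' →L[ℝ] E' →L[ℝ] ℝ) (Φ : E → E') (x u v : E) : E' :=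
  fderiv ℝ (fderiv ℝ Φ) x u v + christoffel G' (Φ x) (fderiv ℝ Φ x u) (fderiv ℝ Φ x v)

/-- The second fundamental form of an immersion in coordinates. -/
noncomputable def secondForm (G : E → E →L[ℝ] E →L[ℝ] ℝ) (G' : E' → E' →L[ℝ] E' →L[ℝ] ℝ)
    (Φ : E → E') (x u v : E) : E' :=
  ambientHessian G' Φ x u v - fderiv ℝ Φ x (christoffel G x u v)

/-- An isometric immersion in coordinates. -/
structure IsIsometricOn (G : E → E →L[ℝ] E →L[ℝ] ℝ) (G' : E' → E' →L[ℝ] E' →L[ℝ] ℝ)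
    (Φ : E → E') (U : Set E) (U' : Set E') : Prop where
  source : IsMetricOn G U
  target : IsMetricOn G' U'
  smooth : ContDiffOn ℝ ∞ Φ U
  mapsTo : Set.MapsTo Φ U U'
  isometric : ∀ x ∈ U, ∀ u v, G x u v = G' (Φ x) (fderiv ℝ Φ x u) (fderiv ℝ Φ x v)

namespace IsIsometricOn

variable {G : E → E →L[ℝ] E →L[ℝ] ℝ} {G' : E' → E' →L[ℝ] E' →L[ℝ] ℝ}
    {Φ : E → E'} {U : Set E} {U' : Set E'} {x : E}

theorem contDiffAt (h : IsIsometricOn G G' Φ U U') (hx : x ∈ U) : ContDiffAt ℝ ∞ Φ x :=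
  h.smooth.contDiffAt (h.source.mem_nhds hx)

theorem contDiffAt_fderiv (h : IsIsometricOn G G' Φ U U') (hx : x ∈ U) :
    ContDiffAt ℝ ∞ (fderiv ℝ Φ) x :=
  (h.contDiffAt hx).fderiv_right (by simp)

theorem contDiffAt_fderiv_fderiv (h : IsIsometricOn G G' Φ U U') (hx : x ∈ U) :
    ContDiffAt ℝ ∞ (fderiv ℝ (fderiv ℝ Φ)) x :=
  (h.contDiffAt_fderiv hx).fderiv_right (by simp)

theorem differentiableAt (h : IsIsometricOn G G' Φ U U') (hx : x ∈ U) :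
    DifferentiableAt ℝ Φ x := (h.contDiffAt hx).differentiableAt (by simp)

theorem differentiableAt_fderiv (h : IsIsometricOn G G' Φ U U') (hx : x ∈ U) (u : E) :
    DifferentiableAt ℝ (fun x ↦ fderiv ℝ Φ x u) x :=
  ((h.contDiffAt_fderiv hx).differentiableAt (by simp)).clm_apply (differentiableAt_const u)

theorem fderiv_fderiv_apply (h : IsIsometricOn G G' Φ U U') (hx : x ∈ U) (u v : E) :
    fderiv ℝ (fun x ↦ fderiv ℝ Φ x v) x u = fderiv ℝ (fderiv ℝ Φ) x u v := by
  rw [fderiv_clm_apply_apply ((h.contDiffAt_fderiv hx).differentiableAt (by simp))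
    (differentiableAt_const v)]
  simp

theorem fderiv_fderiv_symm (h : IsIsometricOn G G' Φ U U') (hx : x ∈ U) (u v : E) :
    fderiv ℝ (fderiv ℝ Φ) x u v = fderiv ℝ (fderiv ℝ Φ) x v u :=
  ((h.contDiffAt hx).isSymmSndFDerivAt (by
    rw [minSmoothness_of_isRCLikeNormedField]; exact WithTop.coe_le_coe.2 le_top)).eq u v

theorem ambientHessian_symm (h : IsIsometricOn G G' Φ U U') (hx : x ∈ U) (u v : E) :
    ambientHessian G' Φ x u v = ambientHessian G' Φ x v u := by
  rw [ambientHessian, ambientHessian, h.fderiv_fderiv_symm hx,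
    h.target.christoffel_symm (h.mapsTo hx)]

/-- The derivative of the scalar product of two vector fields along an immersion. -/
theorem fderiv_metric_along (h : IsIsometricOn G G' Φ U U') (hx : x ∈ U) {W Z : E → E'}
    (hW : DifferentiableAt ℝ W x) (hZ : DifferentiableAt ℝ Z x) (u : E) :
    fderiv ℝ (fun x ↦ G' (Φ x) (W x) (Z x)) x u
      = G' (Φ x) (fderiv ℝ W x u + christoffel G' (Φ x) (fderiv ℝ Φ x u) (W x)) (Z x)
        + G' (Φ x) (W x) (fderiv ℝ Z x u + christoffel G' (Φ x) (fderiv ℝ Φ x u) (Z x)) := by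
  have hG := h.target.differentiableAt (h.mapsTo hx)
  rw [fderiv_bilin_apply (G := fun x ↦ G' (Φ x)) (hG.comp x (h.differentiableAt hx)) hW hZ,
    fderiv_fun_comp x hG (h.differentiableAt hx)]
  simp only [ContinuousLinearMap.comp_apply, h.target.fderiv_eq (h.mapsTo hx), map_add, add_apply]
  ring

/-- Differentiating the isometry relation expresses the derivative of `G` through the ambient
Hessian, which is symmetric; the Koszul formula then leaves a single term. Thus the tangential part
of the ambient connection is the Levi-Civita connection of `G`. -/
theorem metric_christoffel (h : IsIsometricOn G G' Φ U U') (hx : x ∈ U) (u v w : E) :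
    G x (christoffel G x u v) w = G' (Φ x) (ambientHessian G' Φ x u v) (fderiv ℝ Φ x w) := by
  have e : ∀ w u v, fderiv ℝ G x w u v
      = G' (Φ x) (ambientHessian G' Φ x w u) (fderiv ℝ Φ x v)
        + G' (Φ x) (ambientHessian G' Φ x w v) (fderiv ℝ Φ x u) := by
    intro w u v
    have h1 := fderiv_bilin_apply (h.source.differentiableAt hx) (differentiableAt_const u)
      (differentiableAt_const v) w
    simp only [fderiv_fun_const, Pi.zero_apply, zero_apply, map_zero, add_zero] at h1
    have h2 : (fun x ↦ G x u v) =ᶠ[nhds x]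
        fun x ↦ G' (Φ x) (fderiv ℝ Φ x u) (fderiv ℝ Φ x v) := by
      filter_upwards [h.source.mem_nhds hx] with z hz using h.isometric z hz u v
    rw [← h1, h2.fderiv_eq, h.fderiv_metric_along hx (h.differentiableAt_fderiv hx u)
      (h.differentiableAt_fderiv hx v), h.fderiv_fderiv_apply hx, h.fderiv_fderiv_apply hx,
      h.target.symm _ (h.mapsTo hx) (fderiv ℝ Φ x u)]
    rfl
  rw [h.source.christoffel_left hx, e, e, e, h.ambientHessian_symm hx w u,
    h.ambientHessian_symm hx w v, h.ambientHessian_symm hx v u]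
  ring

/-- The second fundamental form has normal values. -/
theorem secondForm_normal (h : IsIsometricOn G G' Φ U U') (hx : x ∈ U) (u v w : E) :
    G' (Φ x) (secondForm G G' Φ x u v) (fderiv ℝ Φ x w) = 0 := by
  rw [secondForm, map_sub, sub_apply, ← h.metric_christoffel hx, ← h.isometric x hx, sub_self]

theorem secondForm_symm (h : IsIsometricOn G G' Φ U U') (hx : x ∈ U) (u v : E) :
    secondForm G G' Φ x u v = secondForm G G' Φ x v u := by
  rw [secondForm, secondForm, h.ambientHessian_symm hx, h.source.christoffel_symm hx]

/-- The Gauss equation. -/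
theorem gauss [CompleteSpace E] [CompleteSpace E'] (h : IsIsometricOn G G' Φ U U') (hx : x ∈ U)
    (u v w z : E) :
    G' (Φ x) (curvature G' (Φ x) (fderiv ℝ Φ x u) (fderiv ℝ Φ x v) (fderiv ℝ Φ x w))
        (fderiv ℝ Φ x z)
      = G x (curvature G x u v w) z
        - G' (Φ x) (secondForm G G' Φ x v w) (secondForm G G' Φ x u z)
        + G' (Φ x) (secondForm G G' Φ x u w) (secondForm G G' Φ x v z) := by
  have hx' := h.mapsTo hx
  have hΓ := h.source.differentiableAt_christoffel hx
  have hΓ' := h.target.differentiableAt_christoffel hx'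
  have d1 := (h.contDiffAt_fderiv hx).differentiableAt (by simp)
  have d2 := (h.contDiffAt_fderiv_fderiv hx).differentiableAt (by simp)
  have d3 : ∀ v, DifferentiableAt ℝ (fun x ↦ fderiv ℝ (fderiv ℝ Φ) x v) x := fun v ↦
    d2.clm_apply (differentiableAt_const v)
  have d4 : ∀ v w, DifferentiableAt ℝ (fun x ↦ fderiv ℝ (fderiv ℝ Φ) x v w) x := fun v w ↦
    (d3 v).clm_apply (differentiableAt_const w)
  have d5 : DifferentiableAt ℝ (fun x ↦ christoffel G' (Φ x)) x := hΓ'.comp x (h.differentiableAt hx)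
  have d6 : ∀ v w, DifferentiableAt ℝ
      (fun x ↦ christoffel G' (Φ x) (fderiv ℝ Φ x v) (fderiv ℝ Φ x w)) x := fun v w ↦
    (d5.clm_apply (h.differentiableAt_fderiv hx v)).clm_apply (h.differentiableAt_fderiv hx w)
  have symm3 : ∀ u v w, fderiv ℝ (fderiv ℝ (fderiv ℝ Φ)) x u v w
      = fderiv ℝ (fderiv ℝ (fderiv ℝ Φ)) x v u w := fun u v w ↦ by
    rw [((h.contDiffAt_fderiv hx).isSymmSndFDerivAt (by
      rw [minSmoothness_of_isRCLikeNormedField]; exact WithTop.coe_le_coe.2 le_top)).eq u v]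
  have eH : ∀ u v w, fderiv ℝ (fun x ↦ ambientHessian G' Φ x v w) x u
      = fderiv ℝ (fderiv ℝ (fderiv ℝ Φ)) x u v w
        + (fderiv ℝ (christoffel G') (Φ x) (fderiv ℝ Φ x u) (fderiv ℝ Φ x v) (fderiv ℝ Φ x w)
          + christoffel G' (Φ x) (fderiv ℝ (fderiv ℝ Φ) x u v) (fderiv ℝ Φ x w)
          + christoffel G' (Φ x) (fderiv ℝ Φ x v) (fderiv ℝ (fderiv ℝ Φ) x u w)) := by
    intro u v w
    have : (fun x ↦ ambientHessian G' Φ x v w) = fun x ↦ fderiv ℝ (fderiv ℝ Φ) x v w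
      + christoffel G' (Φ x) (fderiv ℝ Φ x v) (fderiv ℝ Φ x w) := rfl
    rw [this, fderiv_fun_add (d4 v w) (d6 v w), add_apply,
      fderiv_clm_apply_apply (d3 v) (differentiableAt_const w),
      fderiv_clm_apply_apply d2 (differentiableAt_const v),
      fderiv_bilin_apply (G := fun x ↦ christoffel G' (Φ x)) d5 (h.differentiableAt_fderiv hx v)
        (h.differentiableAt_fderiv hx w), h.fderiv_fderiv_apply hx, h.fderiv_fderiv_apply hx,
      fderiv_fun_comp x hΓ' (h.differentiableAt hx)]
    simp
  -- This is `metric_christoffel` differentiated along `u`. Its antisymmetrization in `u` and `v`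
  -- contains both curvatures.
  have key : ∀ u v, G x (fderiv ℝ (christoffel G) x u v w
        + christoffel G x u (christoffel G x v w)) z
        + G x (christoffel G x v w) (christoffel G x u z)
      = G' (Φ x) (fderiv ℝ (fun x ↦ ambientHessian G' Φ x v w) x u
          + christoffel G' (Φ x) (fderiv ℝ Φ x u) (ambientHessian G' Φ x v w)) (fderiv ℝ Φ x z)
        + G' (Φ x) (ambientHessian G' Φ x v w) (ambientHessian G' Φ x u z) := by
    intro u v
    have c1 : DifferentiableAt ℝ (fun x ↦ christoffel G x v) x :=
      hΓ.clm_apply (differentiableAt_const v)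
    have c2 : DifferentiableAt ℝ (fun x ↦ christoffel G x v w) x :=
      c1.clm_apply (differentiableAt_const w)
    have c3 : DifferentiableAt ℝ (fun x ↦ ambientHessian G' Φ x v w) x := (d4 v w).add (d6 v w)
    have e : (fun x ↦ G x (christoffel G x v w) z) =ᶠ[nhds x]
        fun x ↦ G' (Φ x) (ambientHessian G' Φ x v w) (fderiv ℝ Φ x z) := by
      filter_upwards [h.source.mem_nhds hx] with y hy using h.metric_christoffel hy v w z
    have e1 := congrArg (fun A : E →L[ℝ] ℝ ↦ A u) e.fderiv_eq
    rw [h.source.fderiv_metric_apply hx c2 (differentiableAt_const z),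
      h.fderiv_metric_along hx c3 (h.differentiableAt_fderiv hx z), h.fderiv_fderiv_apply hx,
      fderiv_clm_apply_apply c1 (differentiableAt_const w),
      fderiv_clm_apply_apply hΓ (differentiableAt_const v)] at e1
    simpa [ambientHessian] using e1
  -- Orthogonal decomposition into normal and tangential parts; the tangential products cancel those
  -- on the other side of `key`.
  have split : ∀ a b c d, G' (Φ x) (ambientHessian G' Φ x a b) (ambientHessian G' Φ x c d)
      = G' (Φ x) (secondForm G G' Φ x a b) (secondForm G G' Φ x c d)
        + G x (christoffel G x a b) (christoffel G x c d) := by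
    intro a b c d
    have e : ∀ a b, ambientHessian G' Φ x a b
        = secondForm G G' Φ x a b + fderiv ℝ Φ x (christoffel G x a b) := fun a b ↦ by
      rw [secondForm, sub_add_cancel]
    rw [e a b, e c d, map_add, map_add, add_apply, add_apply, h.secondForm_normal hx,
      h.target.symm _ hx' (fderiv ℝ Φ x _) (secondForm G G' Φ x c d), h.secondForm_normal hx,
      ← h.isometric x hx]
    ring
  have k1 := key u v
  have k2 := key v u
  rw [eH, split] at k1 k2
  rw [symm3 v u w, h.fderiv_fderiv_symm hx v u] at k2
  simp only [ambientHessian, curvature, map_add, map_sub, add_apply, sub_apply] at k1 k2 ⊢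
  linarith

end IsIsometricOn

end LocalRiemann

/-! ### Smoothness of tensors in charts, and their values at the base point. -/

namespace RiemannChart

open LocalRiemann

variable {E : Type*} [NormedAddCommGroup E] [NormedSpace ℝ E]
  {M : Type*} [TopologicalSpace M] [ChartedSpace E M] [IsManifold 𝓘(ℝ, E) ∞ M]

theorem coframe_frame {p : M} {y : E} (hy : y ∈ (extChartAt 𝓘(ℝ, E) p).target) (u : E) :
    coframe p _ (frame p y u) = u := by
  have h := mfderiv_extChartAt_comp_mfderivWithin_extChartAt_symm (I := 𝓘(ℝ, E)) (x := p) hy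
  simp only [modelWithCornersSelf_coe, Set.range_id, mfderivWithin_univ] at h
  exact congrArg (fun A : E →L[ℝ] E ↦ A u) h

theorem frame_coframe {p : M} {y : E} (hy : y ∈ (extChartAt 𝓘(ℝ, E) p).target)
    (X : TangentSpace 𝓘(ℝ, E) ((extChartAt 𝓘(ℝ, E) p).symm y)) :
    frame p y (coframe p _ X) = X := by
  have h := mfderivWithin_extChartAt_symm_comp_mfderiv_extChartAt (I := 𝓘(ℝ, E)) (x := p) hy
  simp only [modelWithCornersSelf_coe, Set.range_id, mfderivWithin_univ] at h
  exact congrArg (fun A : TangentSpace 𝓘(ℝ, E) ((extChartAt 𝓘(ℝ, E) p).symm y) →L[ℝ]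
    TangentSpace 𝓘(ℝ, E) ((extChartAt 𝓘(ℝ, E) p).symm y) ↦ A X) h

/-- The chart around `p` identifies the tangent space at `p` with `E` by the identity. -/
theorem coframe_self_apply (p q : M) (hq : q = p) (u : E) :
    (coframe (E := E) p q : E →L[ℝ] E) u = u := by
  subst hq
  have h : (coframe (E := E) q q : E →L[ℝ] E)
      = fderivWithin ℝ (extChartAt 𝓘(ℝ, E) q ∘ (extChartAt 𝓘(ℝ, E) q).symm)
        (Set.range 𝓘(ℝ, E)) (extChartAt 𝓘(ℝ, E) q q) :=
    (mdifferentiableAt_extChartAt (mem_chart_source E q)).mfderiv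
  rw [h, ← tangentBundleCore_coordChange_achart]
  exact (tangentBundleCore 𝓘(ℝ, E) M).coordChange_self (achart E q) q (mem_chart_source E q) u

theorem frame_self_apply (p : M) (u : E) :
    (frame p (extChartAt 𝓘(ℝ, E) p p) u : E) = u := by
  have h := coframe_frame (mem_extChartAt_target (I := 𝓘(ℝ, E)) p) u
  have h2 := coframe_self_apply (E := E) p _ (extChartAt_to_inv (I := 𝓘(ℝ, E)) p)
    (frame p (extChartAt 𝓘(ℝ, E) p p) u)
  exact h2.symm.trans h

/-- The frame is the tangent map of the inverse chart applied to a constant section, hence smooth as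
a map into the tangent bundle. -/
theorem contMDiffOn_frame (p : M) (u : E) :
    ContMDiffOn 𝓘(ℝ, E) 𝓘(ℝ, E).tangent ∞
      (fun y ↦ (⟨(extChartAt 𝓘(ℝ, E) p).symm y, frame p y u⟩ : TangentBundle 𝓘(ℝ, E) M))
      (extChartAt 𝓘(ℝ, E) p).target := by
  have ho : IsOpen (extChartAt 𝓘(ℝ, E) p).target := isOpen_extChartAt_target p
  have h1 : ContMDiffOn 𝓘(ℝ, E).tangent 𝓘(ℝ, E).tangent ∞
      (tangentMapWithin 𝓘(ℝ, E) 𝓘(ℝ, E) (extChartAt 𝓘(ℝ, E) p).symm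
        (extChartAt 𝓘(ℝ, E) p).target) _ :=
    (contMDiffOn_extChartAt_symm (I := 𝓘(ℝ, E)) (n := ∞) p).contMDiffOn_tangentMapWithin
      (by simp) ho.uniqueMDiffOn
  have h2 : ContMDiffOn 𝓘(ℝ, E) 𝓘(ℝ, E).tangent ∞
      (fun y ↦ (⟨y, u⟩ : TangentBundle 𝓘(ℝ, E) E)) (extChartAt 𝓘(ℝ, E) p).target :=
    contMDiffOn_vectorSpace_iff_contDiffOn.2 contDiffOn_const
  refine (h1.comp h2 fun y hy ↦ hy).congr fun y hy ↦ ?_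
  simp only [Function.comp, tangentMapWithin, mfderivWithin_of_mem_nhds (ho.mem_nhds hy)]
  rfl

theorem contDiffOn_coframe (p : M)
    (X : ∀ y : E, TangentSpace 𝓘(ℝ, E) ((extChartAt 𝓘(ℝ, E) p).symm y))
    (hX : ContMDiffOn 𝓘(ℝ, E) 𝓘(ℝ, E).tangent ∞
      (fun y ↦ (⟨(extChartAt 𝓘(ℝ, E) p).symm y, X y⟩ : TangentBundle 𝓘(ℝ, E) M))
      (extChartAt 𝓘(ℝ, E) p).target) :
    ContDiffOn ℝ ∞ (fun y ↦ (coframe p _ (X y) : E)) (extChartAt 𝓘(ℝ, E) p).target := by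
  have ho : IsOpen (chartAt E p).source := (chartAt E p).open_source
  have h1 : ContMDiffOn 𝓘(ℝ, E).tangent 𝓘(ℝ, E).tangent ∞
      (tangentMapWithin 𝓘(ℝ, E) 𝓘(ℝ, E) (extChartAt 𝓘(ℝ, E) p) (chartAt E p).source) _ :=
    (contMDiffOn_extChartAt (I := 𝓘(ℝ, E)) (n := ∞) (x := p)).contMDiffOn_tangentMapWithin
      (by simp) ho.uniqueMDiffOn
  have hs : ∀ y ∈ (extChartAt 𝓘(ℝ, E) p).target,
      (extChartAt 𝓘(ℝ, E) p).symm y ∈ (chartAt E p).source := fun y hy ↦ by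
    rw [← extChartAt_source 𝓘(ℝ, E)]
    exact (extChartAt 𝓘(ℝ, E) p).map_target hy
  have h2 := (contMDiff_snd_tangentBundle_modelSpace (n := ∞) E 𝓘(ℝ, E)).comp_contMDiffOn
    (h1.comp hX fun y hy ↦ hs y hy)
  refine (contMDiffOn_iff_contDiffOn.1 h2).congr fun y hy ↦ ?_
  simp only [Function.comp, tangentMapWithin, mfderivWithin_of_mem_nhds (ho.mem_nhds (hs y hy))]
  rfl

theorem contDiffOn_coordField (X : ∀ q : M, TangentSpace 𝓘(ℝ, E) q)
    (hX : ContMDiff 𝓘(ℝ, E) 𝓘(ℝ, E).tangent ∞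
      (fun q ↦ (⟨q, X q⟩ : TangentBundle 𝓘(ℝ, E) M))) (p : M) :
    ContDiffOn ℝ ∞ (coordField X p) (extChartAt 𝓘(ℝ, E) p).target :=
  contDiffOn_coframe p _ (hX.comp_contMDiffOn (contMDiffOn_extChartAt_symm p))

theorem contDiffOn_coordEndo [FiniteDimensional ℝ E]
    (f : ∀ q : M, TangentSpace 𝓘(ℝ, E) q →L[ℝ] TangentSpace 𝓘(ℝ, E) q)
    (hf : ContMDiff 𝓘(ℝ, E) (𝓘(ℝ, E).prod 𝓘(ℝ, E →L[ℝ] E)) ∞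
      (fun q ↦ Bundle.TotalSpace.mk' (E →L[ℝ] E)
        (E := fun q : M ↦ TangentSpace 𝓘(ℝ, E) q →L[ℝ] TangentSpace 𝓘(ℝ, E) q) q (f q))) (p : M) :
    ContDiffOn ℝ ∞ (coordEndo f p) (extChartAt 𝓘(ℝ, E) p).target := by
  rw [contDiffOn_clm_apply]
  intro u
  refine contDiffOn_coframe p (fun y ↦ f _ (frame p y u)) ?_
  have h1 := hf.comp_contMDiffOn (contMDiffOn_extChartAt_symm (I := 𝓘(ℝ, E)) (n := ∞) p)
  exact ContMDiffOn.clm_bundle_apply h1 (contMDiffOn_frame p u)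

theorem coordField_self (X : ∀ q : M, TangentSpace 𝓘(ℝ, E) q) (p : M) :
    coordField X p (extChartAt 𝓘(ℝ, E) p p) = X p := by
  -- The point obtained by applying the chart and its inverse to `p` equals `p` only
  -- propositionally, so its fibre is a different type; generalizing to `q` permits substitution.
  have key : ∀ q, q = p → (coframe (E := E) p q (X q) : E) = X p := by
    rintro q rfl
    exact coframe_self_apply (E := E) q q rfl (X q)
  exact key _ (extChartAt_to_inv p)

theorem coordEndo_self (f : ∀ q : M, TangentSpace 𝓘(ℝ, E) q →L[ℝ] TangentSpace 𝓘(ℝ, E) q)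
    (p : M) (u : E) : coordEndo f p (extChartAt 𝓘(ℝ, E) p p) u = f p u := by
  have key : ∀ (q : M) (v : TangentSpace 𝓘(ℝ, E) q), q = p → (v : E) = u →
      (coframe (E := E) p q (f q v) : E) = f p u := by
    rintro q v rfl rfl
    exact coframe_self_apply (E := E) q q rfl (f q v)
  exact key _ _ (extChartAt_to_inv p) (frame_self_apply p u)

variable [RiemannianBundle (fun q : M ↦ TangentSpace 𝓘(ℝ, E) q)]

theorem coordMetric_self (p : M) (u v : TangentSpace 𝓘(ℝ, E) p) :
    coordMetric (E := E) p (extChartAt 𝓘(ℝ, E) p p) u v = inner ℝ u v := by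
  have key : ∀ (q : M) (a b : TangentSpace 𝓘(ℝ, E) q), q = p → (a : E) = (u : E) →
      (b : E) = (v : E) → (inner ℝ a b : ℝ) = inner ℝ u v := by
    rintro q a b rfl rfl rfl
    rfl
  exact key _ _ _ (extChartAt_to_inv p) (frame_self_apply (E := E) p u)
    (frame_self_apply (E := E) p v)

variable [FiniteDimensional ℝ E]
  [IsContMDiffRiemannianBundle 𝓘(ℝ, E) ∞ E (fun q : M ↦ TangentSpace 𝓘(ℝ, E) q)]

theorem isMetricOn_coordMetric (p : M) :
    IsMetricOn (coordMetric (E := E) p) (extChartAt 𝓘(ℝ, E) p).target where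
  isOpen := isOpen_extChartAt_target p
  smooth := by
    rw [contDiffOn_clm_apply]
    intro u
    rw [contDiffOn_clm_apply]
    intro v
    exact contMDiffOn_iff_contDiffOn.1
      (ContMDiffOn.inner_bundle (IB := 𝓘(ℝ, E)) (F := E)
        (E := fun q : M ↦ TangentSpace 𝓘(ℝ, E) q) (v := fun y ↦ frame p y u)
        (w := fun y ↦ frame p y v) (contMDiffOn_frame p u) (contMDiffOn_frame p v))
  symm y _ u v := by rw [coordMetric_apply, coordMetric_apply, real_inner_comm]
  inv y hy := by
    have hi : Function.Injective (coordMetric p y) := by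
      rw [injective_iff_map_eq_zero]
      intro a ha
      have h0 : (inner ℝ (frame p y a) (frame p y a) : ℝ) = 0 := by
        rw [← coordMetric_apply, ha]; rfl
      rw [inner_self_eq_zero] at h0
      rw [← coframe_frame hy a, h0, map_zero]
    have hd : Module.finrank ℝ E = Module.finrank ℝ (E →L[ℝ] ℝ) := by
      rw [← (LinearMap.toContinuousLinearMap (𝕜 := ℝ) (E := E) (F' := ℝ)).finrank_eq]
      exact (Subspace.dual_finrank_eq (K := ℝ) (V := E)).symm
    exact ⟨(LinearEquiv.ofInjectiveOfFinrankEq (coordMetric p y).toLinearMap hi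
      hd).toContinuousLinearEquiv, by ext; rfl⟩

end RiemannChart

/-! ### Metric f-structures in charts, and curvature identities on `C`-manifolds. -/

namespace MetricFStructure

open LocalRiemann RiemannChart

variable {E : Type*} [NormedAddCommGroup E] [NormedSpace ℝ E]
  {M : Type*} [TopologicalSpace M] [ChartedSpace E M] [IsManifold 𝓘(ℝ, E) ∞ M]
  [RiemannianBundle (fun q : M ↦ TangentSpace 𝓘(ℝ, E) q)]
  {s : ℕ} (S : MetricFStructure E M s)

theorem η_eq_inner (α : Fin s) (q : M) (X : TangentSpace 𝓘(ℝ, E) q) :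
    S.η α q X = inner ℝ (S.ξ α q) X := by
  rw [S.metric]
  simp [S.f_ξ, S.η_ξ]

theorem inner_ξ_ξ (α β : Fin s) (q : M) :
    (inner ℝ (S.ξ α q) (S.ξ β q) : ℝ) = if α = β then 1 else 0 := by
  rw [← S.η_eq_inner, S.η_ξ]

theorem inner_ξ_f (α : Fin s) (q : M) (X : TangentSpace 𝓘(ℝ, E) q) :
    (inner ℝ (S.ξ α q) (S.f q X) : ℝ) = 0 := by
  rw [← S.η_eq_inner, S.η_f]

theorem inner_f_left (q : M) (X Y : TangentSpace 𝓘(ℝ, E) q) :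
    (inner ℝ (S.f q X) Y : ℝ) = - inner ℝ X (S.f q Y) := by
  rw [S.metric q (S.f q X) Y, S.f_sq]
  simp only [S.η_f, zero_mul, Finset.sum_const_zero, add_zero, inner_add_left, inner_neg_left,
    sum_inner, real_inner_smul_left, S.inner_ξ_f, mul_zero]

variable [FiniteDimensional ℝ E]
  [IsContMDiffRiemannianBundle 𝓘(ℝ, E) ∞ E (fun q : M ↦ TangentSpace 𝓘(ℝ, E) q)]

theorem isMetricFOn (p : M) :
    IsMetricFOn (coordMetric (E := E) p) (coordEndo S.f p) (fun α ↦ coordField (S.ξ α) p)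
      (extChartAt 𝓘(ℝ, E) p).target where
  toIsMetricOn := isMetricOn_coordMetric p
  smooth_f := contDiffOn_coordEndo S.f S.smooth_f p
  smooth_ξ α := contDiffOn_coordField (S.ξ α) (S.smooth_ξ α) p
  metric_ξ y hy α β := by
    rw [coordMetric_apply, coordField, coordField, frame_coframe hy, frame_coframe hy, S.inner_ξ_ξ]
  f_ξ y hy α := by
    simp only [coordEndo, coordField, ContinuousLinearMap.comp_apply]
    rw [frame_coframe hy, S.f_ξ, map_zero]
  f_sq y hy v := by
    simp only [coordEndo, coordField, ContinuousLinearMap.comp_apply, coordMetric_apply]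
    rw [frame_coframe hy, S.f_sq]
    simp only [map_add, map_neg, map_sum, map_smul]
    rw [coframe_frame hy]
    simp only [S.η_eq_inner, frame_coframe hy]
  f_skew y hy u v := by
    simp only [coordEndo, ContinuousLinearMap.comp_apply, coordMetric_apply]
    rw [frame_coframe hy, frame_coframe hy, S.inner_f_left]

theorem parallel (hC : S.IsCManifold) (p : M) {y : E}
    (hy : y ∈ (extChartAt 𝓘(ℝ, E) p).target) :
    (∀ α, covField (coordMetric p) (coordField (S.ξ α) p) y = 0) ∧
      covEndo (coordMetric p) (coordEndo S.f p) y = 0 := by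
  refine (S.isMetricFOn p).parallel hy (fun u v ↦ ?_) (hC.isK.closed p y hy) fun α u v ↦ ?_
  · simpa [hC.closed_η _ p y hy] using hC.isK.normal p y hy u v
  · have h := hC.closed_η α p y hy u v
    have e : (fun z ↦ coordMetric p z (coordField (S.ξ α) p z)) =ᶠ[nhds y]
        coordForm (S.η α) p := by
      filter_upwards [(isOpen_extChartAt_target (I := 𝓘(ℝ, E)) p).mem_nhds hy] with z hz
      ext w
      rw [coordMetric_apply, coordField, frame_coframe hz, coordForm,
        ContinuousLinearMap.comp_apply, S.η_eq_inner]
    rw [dOneForm, e.fderiv_eq]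
    exact h

/-- The structure vector fields of a `C`-manifold are annihilated by the curvature. -/
theorem riemann_ξ (hC : S.IsCManifold) (p : M) (α : Fin s) (u v : TangentSpace 𝓘(ℝ, E) p) :
    riemann p u v (S.ξ α p) = 0 := by
  have : CompleteSpace E := FiniteDimensional.complete ℝ E
  have h := (isMetricOn_coordMetric (E := E) p).curvature_parallel_field
    (mem_extChartAt_target p) (contDiffOn_coordField (S.ξ α) (S.smooth_ξ α) p)
    (fun z hz w ↦ congrArg (fun A : E →L[ℝ] E ↦ A w) ((S.parallel hC p hz).1 α)) u v
  rw [coordField_self] at h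
  exact h

/-- The curvature of a `C`-manifold commutes with `f`. -/
theorem riemann_f (hC : S.IsCManifold) (p : M) (u v w : TangentSpace 𝓘(ℝ, E) p) :
    riemann p u v (S.f p w) = S.f p (riemann p u v w) := by
  have : CompleteSpace E := FiniteDimensional.complete ℝ E
  have h := (isMetricOn_coordMetric (E := E) p).curvature_parallel_endo
    (mem_extChartAt_target p) (contDiffOn_coordEndo S.f S.smooth_f p)
    (fun z hz a b ↦ congrArg (fun A : E →L[ℝ] E →L[ℝ] E ↦ A a b) (S.parallel hC p hz).2) u v w
  exact (congrArg (riemann p u v) (coordEndo_self (E := E) S.f p w).symm).trans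
    (h.trans (coordEndo_self (E := E) S.f p _))

end MetricFStructure

/-! ### Parallel ambient fields tangent to a submanifold. -/

namespace LocalRiemann

variable {E : Type*} [NormedAddCommGroup E] [NormedSpace ℝ E]
  {E' : Type*} [NormedAddCommGroup E'] [NormedSpace ℝ E']
  {G : E → E →L[ℝ] E →L[ℝ] ℝ} {G' : E' → E' →L[ℝ] E' →L[ℝ] ℝ}
  {Φ : E → E'} {U : Set E} {U' : Set E'} {x : E}

/-- The second fundamental form annihilates a parallel ambient vector field that is tangent to the
submanifold. -/
theorem IsIsometricOn.secondForm_parallel [CompleteSpace E] (h : IsIsometricOn G G' Φ U U')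
    (hx : x ∈ U) {ξ : E' → E'} (hξ : DifferentiableAt ℝ ξ (Φ x))
    (par : covField G' ξ (Φ x) = 0) (tan : ∀ z ∈ U, ∃ a, fderiv ℝ Φ z a = ξ (Φ z))
    (u a : E) (ha : fderiv ℝ Φ x a = ξ (Φ x)) : secondForm G G' Φ x u a = 0 := by
  -- The preimage of `ξ` under `fderiv ℝ Φ`, written by raising an index: pointwise existence in
  -- `tan` gives no regularity, whereas this formula is visibly differentiable.
  let ζ : E → E := fun z ↦ (G z).inverse (G' (Φ z) (ξ (Φ z)) ∘L fderiv ℝ Φ z)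
  have ζ_eq : ∀ z ∈ U, ∀ b, fderiv ℝ Φ z b = ξ (Φ z) → ζ z = b := by
    intro z hz b hb
    have e : G' (Φ z) (ξ (Φ z)) ∘L fderiv ℝ Φ z = G z b := by
      ext w
      rw [h.isometric z hz, hb, ContinuousLinearMap.comp_apply]
    exact (congrArg (G z).inverse e).trans ((h.source.inv z hz).inverse_apply_eq.2 rfl)
  have hζ : ∀ z ∈ U, fderiv ℝ Φ z (ζ z) = ξ (Φ z) := by
    intro z hz
    obtain ⟨b, hb⟩ := tan z hz
    rw [ζ_eq z hz b hb, hb]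
  have dΦ := h.differentiableAt hx
  have dDΦ := (h.contDiffAt_fderiv hx).differentiableAt (by simp)
  have dζ : DifferentiableAt ℝ ζ x := by
    have d1 : DifferentiableAt ℝ (fun z ↦ (G z).inverse) x :=
      (((h.source.inv x hx).contDiffAt_map_inverse (n := ∞)).differentiableAt (by simp)).comp x
        (h.source.differentiableAt hx)
    have d2 : DifferentiableAt ℝ (fun z ↦ ξ (Φ z)) x := hξ.comp x dΦ
    have d3 : DifferentiableAt ℝ (fun z ↦ G' (Φ z)) x :=
      (h.target.differentiableAt (h.mapsTo hx)).comp x dΦ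
    exact d1.clm_apply ((d3.clm_apply d2).clm_comp dDΦ)
  have e : (fun z ↦ fderiv ℝ Φ z (ζ z)) =ᶠ[nhds x] fun z ↦ ξ (Φ z) := by
    filter_upwards [h.source.mem_nhds hx] with z hz using hζ z hz
  have e1 := congrArg (fun A : E →L[ℝ] E' ↦ A u) e.fderiv_eq
  rw [fderiv_clm_apply_apply dDΦ dζ, fderiv_fun_comp x hξ dΦ, ContinuousLinearMap.comp_apply,
    ζ_eq x hx a ha] at e1
  have e2 := congrArg (fun A : E' →L[ℝ] E' ↦ A (fderiv ℝ Φ x u)) par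
  rw [covField_apply, ← e1, ← ha] at e2
  -- The Gauss formula with vanishing ambient derivative: this vector is tangent, while
  -- `secondForm_normal` makes it normal, so it is zero.
  have e3 : secondForm G G' Φ x u a
      = fderiv ℝ Φ x (- (fderiv ℝ ζ x u + christoffel G x u a)) := by
    rw [secondForm, ambientHessian, map_neg, map_add, ← sub_eq_zero]
    rw [zero_apply] at e2
    rw [← e2]
    abel
  have e4 : - (fderiv ℝ ζ x u + christoffel G x u a) = 0 := by
    refine h.source.eq_of_forall hx fun w ↦ ?_
    rw [h.isometric x hx, ← e3, h.secondForm_normal hx]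
    simp
  rw [e3, e4, map_zero]

end LocalRiemann

/-! ### Isometric immersions read in charts. -/

namespace RiemannChart

variable {E : Type*} [NormedAddCommGroup E] [NormedSpace ℝ E]
  {M : Type*} [TopologicalSpace M] [ChartedSpace E M]

theorem coordField_extChartAt (X : ∀ q : M, TangentSpace 𝓘(ℝ, E) q) (p q : M)
    (hq : q ∈ (extChartAt 𝓘(ℝ, E) p).source) :
    coordField X p (extChartAt 𝓘(ℝ, E) p q) = coframe p q (X q) := by
  rw [coordField, (extChartAt 𝓘(ℝ, E) p).left_inv hq]

theorem coordMetric_extChartAt [IsManifold 𝓘(ℝ, E) ∞ M]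
    [RiemannianBundle (fun q : M ↦ TangentSpace 𝓘(ℝ, E) q)] (p q : M)
    (hq : q ∈ (extChartAt 𝓘(ℝ, E) p).source) (X Y : TangentSpace 𝓘(ℝ, E) q) :
    coordMetric (E := E) p (extChartAt 𝓘(ℝ, E) p q) (coframe p q X) (coframe p q Y)
      = inner ℝ X Y := by
  obtain ⟨y, hy, rfl⟩ : ∃ y ∈ (extChartAt 𝓘(ℝ, E) p).target,
      (extChartAt 𝓘(ℝ, E) p).symm y = q :=
    ⟨_, (extChartAt 𝓘(ℝ, E) p).map_source hq, (extChartAt 𝓘(ℝ, E) p).left_inv hq⟩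
  rw [(extChartAt 𝓘(ℝ, E) p).right_inv hy, coordMetric_apply, frame_coframe hy, frame_coframe hy]

end RiemannChart

namespace Immersed

open LocalRiemann RiemannChart

variable {E : Type*} [NormedAddCommGroup E] [NormedSpace ℝ E]
  {M : Type*} [TopologicalSpace M] [ChartedSpace E M]
  {E' : Type*} [NormedAddCommGroup E'] [NormedSpace ℝ E']
  {M' : Type*} [TopologicalSpace M'] [ChartedSpace E' M']

variable (E E') in
/-- The coordinates at `p` for which `φ` is defined in the charts at `p` and `φ p`. -/
def coordDomain (φ : M → M') (p : M) : Set E :=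
  (extChartAt 𝓘(ℝ, E) p).target ∩
    (extChartAt 𝓘(ℝ, E) p).symm ⁻¹' (φ ⁻¹' (extChartAt 𝓘(ℝ, E') (φ p)).source)

theorem mem_coordDomain (φ : M → M') (p : M) :
    extChartAt 𝓘(ℝ, E) p p ∈ coordDomain E E' φ p := by
  refine ⟨mem_extChartAt_target p, ?_⟩
  simp only [Set.mem_preimage, extChartAt_to_inv]
  exact mem_extChartAt_source (φ p)

variable [RiemannianBundle (fun q : M ↦ TangentSpace 𝓘(ℝ, E) q)]
  [RiemannianBundle (fun q : M' ↦ TangentSpace 𝓘(ℝ, E') q)]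
  {φ : M → M'}

theorem IsIsometricImmersion.fderiv_coordMap_self (hφ : IsIsometricImmersion E E' φ) (p : M) :
    fderiv ℝ (coordMap E E' φ p) (extChartAt 𝓘(ℝ, E) p p) = mfderiv 𝓘(ℝ, E) 𝓘(ℝ, E') φ p := by
  have d : MDifferentiableAt 𝓘(ℝ, E) 𝓘(ℝ, E') φ p :=
    hφ.smooth.contMDiffAt.mdifferentiableAt (by simp)
  rw [d.mfderiv, modelWithCornersSelf_coe, Set.range_id, fderivWithin_univ]
  rfl

variable [IsManifold 𝓘(ℝ, E) ∞ M] [IsManifold 𝓘(ℝ, E') ∞ M']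

namespace IsIsometricImmersion

theorem contMDiffOn_coordMap (hφ : IsIsometricImmersion E E' φ) (p : M) :
    ContMDiffOn 𝓘(ℝ, E) 𝓘(ℝ, E') ∞ (coordMap E E' φ p) (coordDomain E E' φ p) := by
  have h1 := (contMDiffOn_extChartAt_symm (I := 𝓘(ℝ, E)) (n := ∞) p).mono
    (Set.inter_subset_left : coordDomain E E' φ p ⊆ _)
  have h2 := hφ.smooth.comp_contMDiffOn h1
  refine (contMDiffOn_extChartAt (I := 𝓘(ℝ, E')) (n := ∞) (x := φ p)).comp h2 fun y hy ↦ ?_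
  rw [← extChartAt_source 𝓘(ℝ, E')]
  exact hy.2

theorem fderiv_coordMap (hφ : IsIsometricImmersion E E' φ) (p : M) {x : E}
    (hx : x ∈ coordDomain E E' φ p) (u : E) :
    fderiv ℝ (coordMap E E' φ p) x u
      = coframe (φ p) _ (mfderiv 𝓘(ℝ, E) 𝓘(ℝ, E') φ _ (frame p x u)) := by
  have d1 : MDifferentiableAt 𝓘(ℝ, E) 𝓘(ℝ, E) (extChartAt 𝓘(ℝ, E) p).symm x :=
    ((contMDiffOn_extChartAt_symm (I := 𝓘(ℝ, E)) (n := ∞) p).contMDiffAt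
      ((isOpen_extChartAt_target p).mem_nhds hx.1)).mdifferentiableAt (by simp)
  have d2 : MDifferentiableAt 𝓘(ℝ, E) 𝓘(ℝ, E') φ ((extChartAt 𝓘(ℝ, E) p).symm x) :=
    hφ.smooth.contMDiffAt.mdifferentiableAt (by simp)
  have d3 : MDifferentiableAt 𝓘(ℝ, E') 𝓘(ℝ, E') (extChartAt 𝓘(ℝ, E') (φ p))
      (φ ((extChartAt 𝓘(ℝ, E) p).symm x)) :=
    mdifferentiableAt_extChartAt (by rw [← extChartAt_source 𝓘(ℝ, E')]; exact hx.2)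
  have e : mfderiv 𝓘(ℝ, E) 𝓘(ℝ, E') (coordMap E E' φ p) x
      = (mfderiv 𝓘(ℝ, E') 𝓘(ℝ, E') (extChartAt 𝓘(ℝ, E') (φ p))
          (φ ((extChartAt 𝓘(ℝ, E) p).symm x))) ∘L
        (mfderiv 𝓘(ℝ, E) 𝓘(ℝ, E') φ ((extChartAt 𝓘(ℝ, E) p).symm x)) ∘L
        (mfderiv 𝓘(ℝ, E) 𝓘(ℝ, E) (extChartAt 𝓘(ℝ, E) p).symm x) := by
    rw [← mfderiv_comp x d2 d1]
    exact mfderiv_comp x d3 (d2.comp x d1)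
  rw [← mfderiv_eq_fderiv]
  exact congrArg (fun A : E →L[ℝ] E' ↦ A u) e

variable [FiniteDimensional ℝ E] [FiniteDimensional ℝ E']
  [IsContMDiffRiemannianBundle 𝓘(ℝ, E) ∞ E (fun q : M ↦ TangentSpace 𝓘(ℝ, E) q)]
  [IsContMDiffRiemannianBundle 𝓘(ℝ, E') ∞ E' (fun q : M' ↦ TangentSpace 𝓘(ℝ, E') q)]

theorem isIsometricOn (hφ : IsIsometricImmersion E E' φ) (p : M) :
    IsIsometricOn (coordMetric (E := E) p) (coordMetric (E := E') (φ p)) (coordMap E E' φ p)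
      (coordDomain E E' φ p) (extChartAt 𝓘(ℝ, E') (φ p)).target where
  source :=
    { isOpen := (contMDiffOn_extChartAt_symm (I := 𝓘(ℝ, E)) (n := ∞) p).continuousOn.isOpen_inter_preimage
          (isOpen_extChartAt_target p)
          ((isOpen_extChartAt_source (φ p)).preimage hφ.smooth.continuous)
      smooth := (isMetricOn_coordMetric p).smooth.mono Set.inter_subset_left
      symm := fun y hy ↦ (isMetricOn_coordMetric p).symm y hy.1
      inv := fun y hy ↦ (isMetricOn_coordMetric p).inv y hy.1 }
  target := isMetricOn_coordMetric (φ p)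
  smooth := contMDiffOn_iff_contDiffOn.1 (hφ.contMDiffOn_coordMap p)
  mapsTo x hx := (extChartAt 𝓘(ℝ, E') (φ p)).map_source hx.2
  isometric x hx u v := by
    rw [hφ.fderiv_coordMap p hx, hφ.fderiv_coordMap p hx, coordMetric_apply, ← hφ.isometric]
    exact (coordMetric_extChartAt (φ p) _ hx.2 _ _).symm

end IsIsometricImmersion

end Immersed

/-! ### Symmetric bilinear forms with values in an inner product space -/

namespace VectorForm

variable {V W : Type*} [NormedAddCommGroup V] [InnerProductSpace ℝ V]
  [NormedAddCommGroup W] [InnerProductSpace ℝ W] {ι : Type*} [Fintype ι]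

theorem sum_inner_smul (b : OrthonormalBasis ι ℝ V) (A : V →ₗ[ℝ] W) (v : V) :
    ∑ i, (inner ℝ (b i) v : ℝ) • A (b i) = A v := by
  conv_rhs => rw [← b.sum_repr' v]
  simp

theorem sum_inner_sq (b : OrthonormalBasis ι ℝ V) (v : V) :
    ∑ i, (inner ℝ (b i) v : ℝ) ^ 2 = ‖v‖ ^ 2 := by
  simpa using b.sum_sq_norm_inner_right v

/-- A completion of squares in the Gauss equation for the Ricci curvature. -/
theorem trace_sub_sq_eq (b : OrthonormalBasis ι ℝ V) (σ : V →ₗ[ℝ] V →ₗ[ℝ] W) (h : W) (U : V)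
    (hU : ‖U‖ = 1) :
    inner ℝ h (σ U U) - ∑ i, ‖σ (b i) U‖ ^ 2
      = ‖h‖ ^ 2 / 4 - ‖σ U U - (1 / 2 : ℝ) • h‖ ^ 2
        - ∑ i, ‖σ (b i) U - (inner ℝ (b i) U : ℝ) • σ U U‖ ^ 2 := by
  have e1 : ∀ i, ‖σ (b i) U - (inner ℝ (b i) U : ℝ) • σ U U‖ ^ 2
      = ‖σ (b i) U‖ ^ 2 - 2 * inner ℝ ((inner ℝ (b i) U : ℝ) • σ (b i) U) (σ U U)
        + (inner ℝ (b i) U : ℝ) ^ 2 * ‖σ U U‖ ^ 2 := by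
    intro i
    rw [norm_sub_sq_real, norm_smul, mul_pow, Real.norm_eq_abs, sq_abs, real_inner_smul_right,
      real_inner_smul_left]
  have e2 : ∑ i, (inner ℝ (b i) U : ℝ) • σ (b i) U = σ U U := sum_inner_smul b (σ.flip U) U
  rw [Finset.sum_congr rfl fun i _ ↦ e1 i, Finset.sum_add_distrib, Finset.sum_sub_distrib,
    ← Finset.mul_sum, ← sum_inner, e2, ← Finset.sum_mul, sum_inner_sq, hU,
    real_inner_self_eq_norm_sq, norm_sub_sq_real, norm_smul, mul_pow, real_inner_smul_right,
    real_inner_comm h, Real.norm_eq_abs, sq_abs]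
  ring

theorem trace_sub_sq_le (b : OrthonormalBasis ι ℝ V) (σ : V →ₗ[ℝ] V →ₗ[ℝ] W) (h : W) (U : V)
    (hU : ‖U‖ = 1) : inner ℝ h (σ U U) - ∑ i, ‖σ (b i) U‖ ^ 2 ≤ ‖h‖ ^ 2 / 4 := by
  rw [trace_sub_sq_eq b σ h U hU]
  have := Finset.sum_nonneg fun i (_ : i ∈ Finset.univ) ↦
    sq_nonneg ‖σ (b i) U - (inner ℝ (b i) U : ℝ) • σ U U‖
  linarith [sq_nonneg ‖σ U U - (1 / 2 : ℝ) • h‖]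

theorem trace_sub_sq_eq_iff (b : OrthonormalBasis ι ℝ V) (σ : V →ₗ[ℝ] V →ₗ[ℝ] W) (h : W) (U : V)
    (hU : ‖U‖ = 1) :
    inner ℝ h (σ U U) - ∑ i, ‖σ (b i) U‖ ^ 2 = ‖h‖ ^ 2 / 4
      ↔ ∀ v, σ v U = (inner ℝ v U : ℝ) • (1 / 2 : ℝ) • h := by
  rw [trace_sub_sq_eq b σ h U hU]
  constructor
  · intro e
    have h0 : ∀ i ∈ Finset.univ, 0 ≤ ‖σ (b i) U - (inner ℝ (b i) U : ℝ) • σ U U‖ ^ 2 :=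
      fun i _ ↦ sq_nonneg _
    have h1 := Finset.sum_nonneg h0
    have h2 := sq_nonneg ‖σ U U - (1 / 2 : ℝ) • h‖
    have e1 : ‖σ U U - (1 / 2 : ℝ) • h‖ ^ 2 = 0 := by linarith
    have e2 := (Finset.sum_eq_zero_iff_of_nonneg h0).1 (by linarith)
    have e3 : σ U U = (1 / 2 : ℝ) • h := by simpa [sub_eq_zero] using e1
    have e4 : ∀ i, σ (b i) U = (inner ℝ (b i) U : ℝ) • (1 / 2 : ℝ) • h := by
      intro i
      have := e2 i (Finset.mem_univ i)
      rw [← e3]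
      simpa [sub_eq_zero] using this
    intro v
    have e5 : ∑ i, (inner ℝ (b i) v : ℝ) • σ (b i) U = σ v U := sum_inner_smul b (σ.flip U) v
    rw [← e5, ← b.sum_inner_mul_inner v U, Finset.sum_smul]
    exact Finset.sum_congr rfl fun i _ ↦ by rw [e4, smul_smul, real_inner_comm]
  · intro e
    have e1 : σ U U = (1 / 2 : ℝ) • h := by
      rw [e, real_inner_self_eq_norm_sq, hU, one_pow, one_smul]
    simp [e]
    simp [hU]

variable {ζ : Fin 2 → V} {σ : V →ₗ[ℝ] V →ₗ[ℝ] W}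

/-- The orthogonal projection to the complement of the vectors `ζ`. -/
theorem exists_decomp (hζ : Orthonormal ℝ ζ) (v : V) :
    ∃ w, (∀ α, (inner ℝ w (ζ α) : ℝ) = 0) ∧ v = w + ∑ α, (inner ℝ (ζ α) v : ℝ) • ζ α := by
  refine ⟨v - ∑ α, (inner ℝ (ζ α) v : ℝ) • ζ α, fun α ↦ ?_, by abel⟩
  rw [inner_sub_left, sum_inner, real_inner_comm]
  simp [real_inner_smul_left, orthonormal_iff_ite.1 hζ]

/-- Both arguments may be projected orthogonally to the `ζ` without changing `σ`, and the bracket is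
the inner product of the projections. -/
theorem umbilical_apply (hζ : Orthonormal ℝ ζ) (symm : ∀ u v, σ u v = σ v u)
    (σζ : ∀ u α, σ u (ζ α) = 0) {N : W}
    (hN : ∀ u v, (∀ α, (inner ℝ u (ζ α) : ℝ) = 0) → (∀ α, (inner ℝ v (ζ α) : ℝ) = 0) →
      σ u v = (inner ℝ u v : ℝ) • N) (u v : V) :
    σ u v = (inner ℝ u v - ∑ α, (inner ℝ (ζ α) u : ℝ) * inner ℝ (ζ α) v) • N := by
  obtain ⟨u', hu, eu⟩ := exists_decomp hζ u
  obtain ⟨v', hv, ev⟩ := exists_decomp hζ v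
  have σζ' : ∀ u α, σ (ζ α) u = 0 := fun u α ↦ by rw [symm, σζ]
  have e1 : σ u v = σ u' v' := by
    conv_lhs => rw [eu, ev]
    simp [σζ, σζ']
  have e2 : (inner ℝ u v : ℝ) = inner ℝ u' v' + ∑ α, (inner ℝ (ζ α) u : ℝ) * inner ℝ (ζ α) v := by
    have e3 : (inner ℝ u' v : ℝ) = inner ℝ u' v' := by
      conv_lhs => rw [ev]
      simp [inner_add_right, real_inner_smul_right, hu]
    conv_lhs => rw [eu]
    rw [inner_add_left, sum_inner, e3]
    simp [real_inner_smul_left]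
  rw [e1, hN u' v' hu hv, e2, add_sub_cancel_right]

/-- The factor is the trace of the projection orthogonal to the two vectors `ζ`, namely `(n + 2) -
2`. -/
theorem umbilical_trace (b : OrthonormalBasis ι ℝ V) {n : ℕ} (hn : Fintype.card ι = n + 2)
    (hζ : Orthonormal ℝ ζ) (symm : ∀ u v, σ u v = σ v u)
    (σζ : ∀ u α, σ u (ζ α) = 0) {N : W}
    (hN : ∀ u v, (∀ α, (inner ℝ u (ζ α) : ℝ) = 0) → (∀ α, (inner ℝ v (ζ α) : ℝ) = 0) →
      σ u v = (inner ℝ u v : ℝ) • N) :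
    ∑ i, σ (b i) (b i) = (n : ℝ) • N := by
  rw [Finset.sum_congr rfl fun i _ ↦ umbilical_apply hζ symm σζ hN (b i) (b i), ← Finset.sum_smul]
  congr 1
  rw [Finset.sum_sub_distrib, Finset.sum_comm]
  have : ∀ α, ∑ i, (inner ℝ (ζ α) (b i) : ℝ) * inner ℝ (ζ α) (b i) = 1 := by
    intro α
    have := sum_inner_sq b (ζ α)
    rw [hζ.1 α, one_pow] at this
    rw [← this]
    exact Finset.sum_congr rfl fun i _ ↦ by rw [real_inner_comm, sq]
  simp [this, hn]

/-- Equality for all unit vectors orthogonal to `ζ` gives umbilicity. -/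
theorem umbilical_of_eq (b : OrthonormalBasis ι ℝ V) (h : W)
    (e : ∀ U, (∀ α, (inner ℝ U (ζ α) : ℝ) = 0) → ‖U‖ = 1 →
      inner ℝ h (σ U U) - ∑ i, ‖σ (b i) U‖ ^ 2 = ‖h‖ ^ 2 / 4)
    (u v : V) (hv : ∀ α, (inner ℝ v (ζ α) : ℝ) = 0) :
    σ u v = (inner ℝ u v : ℝ) • (1 / 2 : ℝ) • h := by
  rcases eq_or_ne v 0 with rfl | h0
  · simp
  have hn : ‖v‖ ≠ 0 := norm_ne_zero_iff.2 h0
  -- The equality case is available only for unit vectors; the general case follows by linearity in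
  -- `v`.
  have h1 : ‖(‖v‖⁻¹ • v)‖ = 1 := by
    rw [norm_smul, norm_inv, norm_norm, inv_mul_cancel₀ hn]
  have h2 := (trace_sub_sq_eq_iff b σ h _ h1).1
    (e _ (fun α ↦ by rw [real_inner_smul_left, hv, mul_zero]) h1) u
  rw [map_smul, real_inner_smul_right, mul_smul] at h2
  exact smul_right_injective W (inv_ne_zero hn) h2

/-- The umbilicity factor is half the trace `h`, so `umbilical_trace` reads `h = (n / 2) h`, which
forces `h = 0` when `n > 2`. -/
theorem eq_zero_of_eq (b : OrthonormalBasis ι ℝ V) {n : ℕ} (hn : Fintype.card ι = n + 2)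
    (hn2 : 2 < n) (hζ : Orthonormal ℝ ζ) (symm : ∀ u v, σ u v = σ v u)
    (σζ : ∀ u α, σ u (ζ α) = 0)
    (e : ∀ U, (∀ α, (inner ℝ U (ζ α) : ℝ) = 0) → ‖U‖ = 1 →
      inner ℝ (∑ i, σ (b i) (b i)) (σ U U) - ∑ i, ‖σ (b i) U‖ ^ 2
        = ‖∑ i, σ (b i) (b i)‖ ^ 2 / 4) (u v : V) : σ u v = 0 := by
  have h1 := fun u v (_ : ∀ α, (inner ℝ u (ζ α) : ℝ) = 0) hv ↦ umbilical_of_eq b _ e u v hv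
  have h2 := umbilical_trace b hn hζ symm σζ h1
  have h3 : ∑ i, σ (b i) (b i) = 0 := by
    have h4 : ((n : ℝ) * (1 / 2) - 1) • ∑ i, σ (b i) (b i) = 0 := by
      rw [sub_smul, one_smul, mul_smul, sub_eq_zero]
      exact h2.symm
    refine (smul_eq_zero.1 h4).resolve_left ?_
    have : (2 : ℝ) < n := by exact_mod_cast hn2
    intro h5
    linarith
  rw [umbilical_apply hζ symm σζ h1, h3]
  simp

/-- Here the trace is `2 N`, so an arbitrary factor `N` is automatically half the trace, as the
equality case demands. -/
theorem eq_of_umbilical (b : OrthonormalBasis ι ℝ V) (hn : Fintype.card ι = 2 + 2)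
    (hζ : Orthonormal ℝ ζ) (symm : ∀ u v, σ u v = σ v u)
    (σζ : ∀ u α, σ u (ζ α) = 0) {N : W}
    (hN : ∀ u v, (∀ α, (inner ℝ u (ζ α) : ℝ) = 0) → (∀ α, (inner ℝ v (ζ α) : ℝ) = 0) →
      σ u v = (inner ℝ u v : ℝ) • N) (U : V) (hU : ∀ α, (inner ℝ U (ζ α) : ℝ) = 0)
    (hU1 : ‖U‖ = 1) :
    inner ℝ (∑ i, σ (b i) (b i)) (σ U U) - ∑ i, ‖σ (b i) U‖ ^ 2
        = ‖∑ i, σ (b i) (b i)‖ ^ 2 / 4 := by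
  rw [trace_sub_sq_eq_iff b σ _ U hU1]
  intro v
  rw [umbilical_trace b hn hζ symm σζ hN, umbilical_apply hζ symm σζ hN]
  simp only [real_inner_comm U, hU]
  simp

end VectorForm

/-! ### Bilinearity of the second fundamental form, and the Gauss equation on manifolds. -/

namespace LocalRiemann

variable {E : Type*} [NormedAddCommGroup E] [NormedSpace ℝ E]
  {E' : Type*} [NormedAddCommGroup E'] [NormedSpace ℝ E']
  (G : E → E →L[ℝ] E →L[ℝ] ℝ) (G' : E' → E' →L[ℝ] E' →L[ℝ] ℝ) (Φ : E → E') (x : E)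

theorem secondForm_add_left (u u' v : E) :
    secondForm G G' Φ x (u + u') v = secondForm G G' Φ x u v + secondForm G G' Φ x u' v := by
  simp only [secondForm, ambientHessian, map_add, add_apply]
  abel

theorem secondForm_add_right (u v v' : E) :
    secondForm G G' Φ x u (v + v') = secondForm G G' Φ x u v + secondForm G G' Φ x u v' := by
  simp only [secondForm, ambientHessian, map_add]
  abel

theorem secondForm_smul_left (c : ℝ) (u v : E) :
    secondForm G G' Φ x (c • u) v = c • secondForm G G' Φ x u v := by
  simp only [secondForm, ambientHessian, map_smul, smul_apply, smul_sub, smul_add]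

theorem secondForm_smul_right (c : ℝ) (u v : E) :
    secondForm G G' Φ x u (c • v) = c • secondForm G G' Φ x u v := by
  simp only [secondForm, ambientHessian, map_smul, smul_sub, smul_add]

end LocalRiemann

namespace Immersed

open LocalRiemann RiemannChart

variable {E : Type*} [NormedAddCommGroup E] [NormedSpace ℝ E]
  {M : Type*} [TopologicalSpace M] [ChartedSpace E M]
  {E' : Type*} [NormedAddCommGroup E'] [NormedSpace ℝ E']
  {M' : Type*} [TopologicalSpace M'] [ChartedSpace E' M']

theorem coordMap_self (φ : M → M') (p : M) :
    coordMap E E' φ p (extChartAt 𝓘(ℝ, E) p p) = extChartAt 𝓘(ℝ, E') (φ p) (φ p) := by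
  rw [coordMap, extChartAt_to_inv]

theorem coordMetric_coordMap [IsManifold 𝓘(ℝ, E') ∞ M']
    [RiemannianBundle (fun q : M' ↦ TangentSpace 𝓘(ℝ, E') q)] (φ : M → M') (p : M)
    (a b : TangentSpace 𝓘(ℝ, E') (φ p)) :
    coordMetric (E := E') (φ p) (coordMap E E' φ p (extChartAt 𝓘(ℝ, E) p p)) a b = inner ℝ a b := by
  rw [← coordMetric_self (E := E') (φ p) a b, ← coordMap_self (E := E)]

variable [RiemannianBundle (fun q : M ↦ TangentSpace 𝓘(ℝ, E) q)]
  [RiemannianBundle (fun q : M' ↦ TangentSpace 𝓘(ℝ, E') q)]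

variable (E E') in
/-- The second fundamental form as a bilinear map. -/
noncomputable def sffForm (φ : M → M') (p : M) :
    TangentSpace 𝓘(ℝ, E) p →ₗ[ℝ] TangentSpace 𝓘(ℝ, E) p →ₗ[ℝ] TangentSpace 𝓘(ℝ, E') (φ p) :=
  LinearMap.mk₂ ℝ (sff E E' φ p)
    (secondForm_add_left (E := E) (E' := E') _ _ _ _)
    (secondForm_smul_left (E := E) (E' := E') _ _ _ _)
    (secondForm_add_right (E := E) (E' := E') _ _ _ _)
    (secondForm_smul_right (E := E) (E' := E') _ _ _ _)

theorem sffForm_apply (φ : M → M') (p : M) (u v : TangentSpace 𝓘(ℝ, E) p) :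
    sffForm E E' φ p u v = sff E E' φ p u v := rfl

variable [IsManifold 𝓘(ℝ, E) ∞ M] [IsManifold 𝓘(ℝ, E') ∞ M'] {φ : M → M'}

namespace IsIsometricImmersion

variable [FiniteDimensional ℝ E] [FiniteDimensional ℝ E']
  [IsContMDiffRiemannianBundle 𝓘(ℝ, E) ∞ E (fun q : M ↦ TangentSpace 𝓘(ℝ, E) q)]
  [IsContMDiffRiemannianBundle 𝓘(ℝ, E') ∞ E' (fun q : M' ↦ TangentSpace 𝓘(ℝ, E') q)]

theorem sff_symm (hφ : IsIsometricImmersion E E' φ) (p : M) (u v : TangentSpace 𝓘(ℝ, E) p) :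
    sff E E' φ p u v = sff E E' φ p v u :=
  (hφ.isIsometricOn p).secondForm_symm (mem_coordDomain φ p) u v

theorem sff_normal (hφ : IsIsometricImmersion E E' φ) (p : M) (u v w : TangentSpace 𝓘(ℝ, E) p) :
    (inner ℝ (sff E E' φ p u v) (mfderiv 𝓘(ℝ, E) 𝓘(ℝ, E') φ p w) : ℝ) = 0 := by
  have h := (hφ.isIsometricOn p).secondForm_normal (mem_coordDomain φ p) u v w
  rw [hφ.fderiv_coordMap_self] at h
  exact (coordMetric_coordMap (E := E) φ p _ _).symm.trans h

/-- The Gauss equation. -/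
theorem gauss (hφ : IsIsometricImmersion E E' φ) (p : M) (u v w z : TangentSpace 𝓘(ℝ, E) p) :
    (inner ℝ (riemann p u v w) z : ℝ)
      = inner ℝ (riemann (φ p) (mfderiv 𝓘(ℝ, E) 𝓘(ℝ, E') φ p u)
          (mfderiv 𝓘(ℝ, E) 𝓘(ℝ, E') φ p v) (mfderiv 𝓘(ℝ, E) 𝓘(ℝ, E') φ p w))
          (mfderiv 𝓘(ℝ, E) 𝓘(ℝ, E') φ p z)
        + inner ℝ (sff E E' φ p v w) (sff E E' φ p u z)
        - inner ℝ (sff E E' φ p u w) (sff E E' φ p v z) := by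
  have : CompleteSpace E := FiniteDimensional.complete ℝ E
  have : CompleteSpace E' := FiniteDimensional.complete ℝ E'
  have h := (hφ.isIsometricOn p).gauss (mem_coordDomain φ p) u v w z
  rw [hφ.fderiv_coordMap_self] at h
  have e0 : (inner ℝ (riemann p u v w) z : ℝ)
      = coordMetric (E := E) p (extChartAt 𝓘(ℝ, E) p p)
        (curvature (E := E) (coordMetric p) (extChartAt 𝓘(ℝ, E) p p) u v w) z :=
    (coordMetric_self (E := E) p _ _).symm
  have e1 : ∀ a b c : TangentSpace 𝓘(ℝ, E') (φ p), riemann (φ p) a b c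
      = curvature (E := E') (coordMetric (φ p))
        (coordMap E E' φ p (extChartAt 𝓘(ℝ, E) p p)) a b c := by
    intro a b c
    rw [coordMap_self]
    rfl
  have e2 : ∀ a b c d : TangentSpace 𝓘(ℝ, E') (φ p), (inner ℝ (riemann (φ p) a b c) d : ℝ)
      = coordMetric (E := E') (φ p) (coordMap E E' φ p (extChartAt 𝓘(ℝ, E) p p))
        (curvature (E := E') (coordMetric (φ p))
          (coordMap E E' φ p (extChartAt 𝓘(ℝ, E) p p)) a b c) d := by
    intro a b c d
    rw [e1]
    exact (coordMetric_coordMap (E := E) φ p _ _).symm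
  -- Inner products on tangent spaces and `coordMetric` on the model space meet only through
  -- definitional unfolding, so the identities are combined as plain real numbers.
  have solve : ∀ {A B C D a b c d : ℝ}, A = a → B = b → c = C → d = D → b = a - c + d →
      A = B + C - D := by
    intros
    linarith
  exact solve e0 (e2 _ _ _ _) (coordMetric_coordMap (E := E) φ p _ _)
    (coordMetric_coordMap (E := E) φ p _ _) h

end IsIsometricImmersion

end Immersed

/-! ### Consequences of parallelism for `σ` and for the coefficient functions. -/

namespace MetricFStructure

open LocalRiemann RiemannChart Immersed

variable {E' : Type*} [NormedAddCommGroup E'] [NormedSpace ℝ E'] [FiniteDimensional ℝ E']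
  {M' : Type*} [TopologicalSpace M'] [ChartedSpace E' M'] [IsManifold 𝓘(ℝ, E') ∞ M']
  [RiemannianBundle (fun q : M' ↦ TangentSpace 𝓘(ℝ, E') q)]
  [IsContMDiffRiemannianBundle 𝓘(ℝ, E') ∞ E' (fun q : M' ↦ TangentSpace 𝓘(ℝ, E') q)]

section Submanifold

variable {E : Type*} [NormedAddCommGroup E] [NormedSpace ℝ E] [FiniteDimensional ℝ E]
  {M : Type*} [TopologicalSpace M] [ChartedSpace E M] [IsManifold 𝓘(ℝ, E) ∞ M]
  [RiemannianBundle (fun q : M ↦ TangentSpace 𝓘(ℝ, E) q)]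
  [IsContMDiffRiemannianBundle 𝓘(ℝ, E) ∞ E (fun q : M ↦ TangentSpace 𝓘(ℝ, E) q)]
  {s : ℕ} (S : MetricFStructure E' M' s) {φ : M → M'}

/-- The second fundamental form of a submanifold of a `C`-manifold annihilates the structure vector
fields. -/
theorem sff_ξ (hC : S.IsCManifold) (hφ : IsIsometricImmersion E E' φ) (hξ : S.IsTangentTo E φ)
    (p : M) (α : Fin s) (u a : TangentSpace 𝓘(ℝ, E) p)
    (ha : mfderiv 𝓘(ℝ, E) 𝓘(ℝ, E') φ p a = S.ξ α (φ p)) : sff E E' φ p u a = 0 := by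
  have : CompleteSpace E := FiniteDimensional.complete ℝ E
  have hx := mem_coordDomain (E := E) (E' := E') φ p
  have hI := hφ.isIsometricOn p
  have hx' := hI.mapsTo hx
  refine hI.secondForm_parallel hx (ξ := coordField (S.ξ α) (φ p))
    (((contDiffOn_coordField (S.ξ α) (S.smooth_ξ α) (φ p)).contDiffAt
      ((isOpen_extChartAt_target (φ p)).mem_nhds hx')).differentiableAt (by simp))
    ((S.parallel hC (φ p) hx').1 α) (fun z hz ↦ ?_) u a ?_
  · obtain ⟨b, hb⟩ := hξ α ((extChartAt 𝓘(ℝ, E) p).symm z)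
    refine ⟨coframe p _ b, ?_⟩
    rw [hφ.fderiv_coordMap p hz, frame_coframe hz.1, hb]
    exact (coordField_extChartAt (S.ξ α) (φ p) _ hz.2).symm
  · rw [hφ.fderiv_coordMap_self, coordMap_self, coordField_self]
    exact ha

end Submanifold

section SpaceForm

variable (S : MetricFStructure E' M' 2) {F₁ F₂ F₃ : M' → ℝ} {Fη : Fin 2 → Fin 2 → M' → ℝ}

/-- The model formula gives `R(Y, ξ α) ξ α = (F₁ - Fη α α) Y`, and the left side is zero. -/
theorem coeff_η (hC : S.IsCManifold) (hF : S.IsGeneralizedSSpaceForm F₁ F₂ F₃ Fη) (q : M')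
    (Y : TangentSpace 𝓘(ℝ, E') q) (hY : ∀ α, (inner ℝ Y (S.ξ α q) : ℝ) = 0) (hY0 : Y ≠ 0)
    (α : Fin 2) : Fη α α q = F₁ q := by
  have h := hF.curvature_eq q Y (S.ξ α q) (S.ξ α q)
  rw [S.riemann_ξ hC] at h
  have hη : ∀ β, S.η β q Y = 0 := fun β ↦ by rw [S.η_eq_inner, real_inner_comm, hY]
  have h2 : (F₁ q - Fη α α q) • Y = 0 := by
    have hn : (inner ℝ (S.ξ α q) (S.ξ α q) : ℝ) = 1 := by
      rw [S.inner_ξ_ξ, if_pos rfl]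
    rw [h, R₁, hn]
    simp only [R₂, R₃, Rη, hη, hY, S.η_ξ, S.f_ξ]
    fin_cases α <;> simp [add_smul, sub_eq_add_neg]
  have h3 := (smul_eq_zero.1 h2).resolve_right hY0
  linarith

/-- For `Y` orthogonal to `X`, `f X` and the `ξ α`, one has `f R(X, Y) Y = F₁ ‖Y‖² f X` and `R(X, Y)
f Y = F₂ ‖Y‖² f X`. Such a nonzero `Y` exists because four vectors cannot span a space of dimension
above four. -/
theorem coeff_f (hC : S.IsCManifold) (hF : S.IsGeneralizedSSpaceForm F₁ F₂ F₃ Fη) (q : M')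
    (hdim : 4 < Module.finrank ℝ E')
    (X : TangentSpace 𝓘(ℝ, E') q) (hX : ∀ α, (inner ℝ X (S.ξ α q) : ℝ) = 0) (hX0 : X ≠ 0) :
    F₁ q = F₂ q := by
  obtain ⟨Y, hY0, hY⟩ : ∃ Y : TangentSpace 𝓘(ℝ, E') q, Y ≠ 0 ∧
      ∀ i, (inner ℝ (![X, S.f q X, S.ξ 0 q, S.ξ 1 q] i) Y : ℝ) = 0 := by
    let b : Fin 4 → TangentSpace 𝓘(ℝ, E') q := ![X, S.f q X, S.ξ 0 q, S.ξ 1 q]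
    have hT : Submodule.span ℝ (Set.range b) ≠ ⊤ := by
      intro htop
      have h1 := finrank_range_le_card (R := ℝ) b
      rw [Set.finrank, htop, finrank_top, Fintype.card_fin] at h1
      exact absurd (lt_of_lt_of_le hdim h1) (lt_irrefl _)
    obtain ⟨Y, hY, hY0⟩ := Submodule.exists_mem_ne_zero_of_ne_bot
      (mt Submodule.orthogonal_eq_bot_iff.1 hT)
    exact ⟨Y, hY0, fun i ↦ hY _ (Submodule.subset_span (Set.mem_range_self i))⟩
  have hXY : (inner ℝ X Y : ℝ) = 0 := hY 0
  have hfXY : (inner ℝ (S.f q X) Y : ℝ) = 0 := hY 1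
  have ξY : ∀ α, (inner ℝ (S.ξ α q) Y : ℝ) = 0 := by
    intro α
    fin_cases α
    · exact hY 2
    · exact hY 3
  have hηX : ∀ β, S.η β q X = 0 := fun β ↦ by rw [S.η_eq_inner, real_inner_comm, hX]
  have hηY : ∀ β, S.η β q Y = 0 := fun β ↦ by rw [S.η_eq_inner, ξY]
  have hXfY : (inner ℝ X (S.f q Y) : ℝ) = 0 := by
    have := S.inner_f_left q X Y
    linarith
  have hYfY : (inner ℝ Y (S.f q Y) : ℝ) = 0 := by
    have := S.inner_f_left q Y Y
    rw [real_inner_comm] at this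
    linarith
  have h := S.riemann_f hC q X Y Y
  rw [hF.curvature_eq, hF.curvature_eq] at h
  have hY2 : (inner ℝ Y Y : ℝ) ≠ 0 := inner_self_ne_zero.2 hY0
  have hfX : S.f q X ≠ 0 := by
    intro h0
    have := S.f_sq q X
    rw [h0, map_zero] at this
    simp only [hηX, zero_smul, Finset.sum_const_zero, add_zero] at this
    exact hX0 (neg_eq_zero.1 this.symm)
  have h2 : ((F₂ q - F₁ q) * inner ℝ Y Y) • S.f q X = 0 := by
    rw [sub_mul, sub_smul, sub_eq_zero, mul_smul, mul_smul]
    simpa only [R₁, R₂, R₃, Rη, hηX, hηY, S.f_sq, hXfY, hYfY, S.η_f, hXY, zero_smul, smul_zero,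
      Finset.sum_const_zero, add_zero, zero_add, sub_zero, zero_sub, mul_zero, zero_mul, neg_zero,
      inner_neg_right, neg_smul, neg_neg, map_smul, map_zero] using h
  have h3 := (mul_eq_zero.1 ((smul_eq_zero.1 h2).resolve_right hfX)).resolve_right hY2
  linarith

end SpaceForm

end MetricFStructure

/-! ### The Ricci curvature of the submanifold. -/

theorem VectorForm.norm_starProjection_range_sq {V W : Type*} [NormedAddCommGroup V]
    [InnerProductSpace ℝ V] [NormedAddCommGroup W] [InnerProductSpace ℝ W] {ι : Type*} [Fintype ι]
    (b : OrthonormalBasis ι ℝ V) (D : V →ₗ[ℝ] W) [(LinearMap.range D).HasOrthogonalProjection]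
    (hD : ∀ u v, (inner ℝ (D u) (D v) : ℝ) = inner ℝ u v) (w : W) :
    ‖(LinearMap.range D).starProjection w‖ ^ 2 = ∑ i, (inner ℝ (D (b i)) w : ℝ) ^ 2 := by
  obtain ⟨t, ht⟩ : ∃ t, D t = (LinearMap.range D).starProjection w :=
    LinearMap.mem_range.1 (Submodule.starProjection_apply_mem _ w)
  have e : ∀ i, (inner ℝ (D (b i)) w : ℝ) = inner ℝ (b i) t := by
    intro i
    rw [← hD, ht, ← Submodule.inner_starProjection_left_eq_right,
      Submodule.starProjection_eq_self_iff.2 (LinearMap.mem_range_self D (b i))]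
  rw [← ht, ← real_inner_self_eq_norm_sq, hD, real_inner_self_eq_norm_sq,
    ← VectorForm.sum_inner_sq b t]
  simp only [e]

namespace Immersed

open RiemannChart

variable {E : Type*} [NormedAddCommGroup E] [NormedSpace ℝ E] [FiniteDimensional ℝ E]
  {M : Type*} [TopologicalSpace M] [ChartedSpace E M]
  [RiemannianBundle (fun q : M ↦ TangentSpace 𝓘(ℝ, E) q)]
  {E' : Type*} [NormedAddCommGroup E'] [NormedSpace ℝ E']
  {M' : Type*} [TopologicalSpace M'] [ChartedSpace E' M']
  [RiemannianBundle (fun q : M' ↦ TangentSpace 𝓘(ℝ, E') q)]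

theorem norm_meanCurvature_sq (φ : M → M') {n : ℕ} (hn : Module.finrank ℝ E = n + 2) (p : M) :
    ((n : ℝ) + 2) ^ 2 / 4 * ‖meanCurvature E E' φ p‖ ^ 2
      = ‖∑ i, sffForm E E' φ p (orthoBasis E p i) (orthoBasis E p i)‖ ^ 2 / 4 := by
  have h0 : (n : ℝ) + 2 ≠ 0 := by positivity
  rw [meanCurvature, norm_smul, mul_pow, Real.norm_eq_abs, sq_abs, hn]
  simp only [sffForm_apply]
  push_cast
  field_simp

end Immersed

namespace MetricFStructure

open LocalRiemann RiemannChart Immersed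

variable {E' : Type*} [NormedAddCommGroup E'] [NormedSpace ℝ E']
  {M' : Type*} [TopologicalSpace M'] [ChartedSpace E' M'] [IsManifold 𝓘(ℝ, E') ∞ M']
  [RiemannianBundle (fun q : M' ↦ TangentSpace 𝓘(ℝ, E') q)]
  {E : Type*} [NormedAddCommGroup E] [NormedSpace ℝ E]
  {M : Type*} [TopologicalSpace M] [ChartedSpace E M]
  [RiemannianBundle (fun q : M ↦ TangentSpace 𝓘(ℝ, E) q)]
  (S : MetricFStructure E' M' 2) {F₁ F₂ F₃ : M' → ℝ} {Fη : Fin 2 → Fin 2 → M' → ℝ} {φ : M → M'}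

/-- The coefficient functions of a generalized `S`-space-form that is a `C`-manifold, at the points
of a submanifold of dimension at least four tangent to the structure vector fields. -/
theorem coeff_submanifold [FiniteDimensional ℝ E']
    [IsContMDiffRiemannianBundle 𝓘(ℝ, E') ∞ E' (fun q : M' ↦ TangentSpace 𝓘(ℝ, E') q)]
    {m n : ℕ} (hm : Module.finrank ℝ E' = 2 * m + 2)
    (hn : Module.finrank ℝ E = n + 2) (hn2 : 2 ≤ n)
    (hC : S.IsCManifold) (hF : S.IsGeneralizedSSpaceForm F₁ F₂ F₃ Fη) (hF₁ : m = 1 → F₁ = F₂)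
    (hφ : IsIsometricImmersion E E' φ) (p : M) (U : TangentSpace 𝓘(ℝ, E) p)
    (hU : U ∈ S.distL E φ p) (hU1 : ‖U‖ = 1) :
    (∀ α, Fη α α (φ p) = F₁ (φ p)) ∧ F₁ (φ p) = F₂ (φ p) := by
  have hD0 : ∀ u, mfderiv 𝓘(ℝ, E) 𝓘(ℝ, E') φ p u = 0 → u = 0 := by
    intro u hu
    have := hφ.isometric p u u
    rw [hu, inner_zero_left] at this
    exact inner_self_eq_zero.1 this.symm
  have hU0 : mfderiv 𝓘(ℝ, E) 𝓘(ℝ, E') φ p U ≠ 0 := by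
    intro h
    rw [hD0 U h, norm_zero] at hU1
    exact zero_ne_one hU1
  refine ⟨fun α ↦ S.coeff_η hC hF (φ p) _ hU hU0 α, ?_⟩
  have hdim : Module.finrank ℝ E ≤ Module.finrank ℝ E' :=
    LinearMap.finrank_le_finrank_of_injective
      (f := (mfderiv 𝓘(ℝ, E) 𝓘(ℝ, E') φ p).toLinearMap)
      ((injective_iff_map_eq_zero _).2 hD0)
  -- Injectivity of the differential gives `n ≤ 2 m`, so `m ≥ 1`; outside the normalized case `m =
  -- 1` the ambient dimension is at least six.
  rcases eq_or_ne m 1 with h1 | h1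
  · rw [hF₁ h1]
  · exact S.coeff_f hC hF (φ p) (by omega) _ hU hU0

/-- The ambient part of the Gauss equation for the Ricci curvature. -/
theorem sum_inner_riemann [FiniteDimensional ℝ E] {n : ℕ} (hn : Module.finrank ℝ E = n + 2)
    (hF : S.IsGeneralizedSSpaceForm F₁ F₂ F₃ Fη)
    (hφ : IsIsometricImmersion E E' φ) (p : M) {ζ : Fin 2 → TangentSpace 𝓘(ℝ, E) p}
    (hζ : ∀ α, mfderiv 𝓘(ℝ, E) 𝓘(ℝ, E') φ p (ζ α) = S.ξ α (φ p))
    (hη : ∀ α, Fη α α (φ p) = F₁ (φ p)) (hf : F₁ (φ p) = F₂ (φ p))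
    (U : TangentSpace 𝓘(ℝ, E) p) (hU : U ∈ S.distL E φ p) (hU1 : ‖U‖ = 1) :
    ∑ i, (inner ℝ (riemann (φ p) (mfderiv 𝓘(ℝ, E) 𝓘(ℝ, E') φ p (orthoBasis E p i))
        (mfderiv 𝓘(ℝ, E) 𝓘(ℝ, E') φ p U) (mfderiv 𝓘(ℝ, E) 𝓘(ℝ, E') φ p U))
        (mfderiv 𝓘(ℝ, E) 𝓘(ℝ, E') φ p (orthoBasis E p i)) : ℝ)
      = (((n : ℝ) - 1) + 3 * ‖S.tanF E φ p U‖ ^ 2) * F₁ (φ p) := by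
  set D := mfderiv 𝓘(ℝ, E) 𝓘(ℝ, E') φ p with hD
  set b := orthoBasis E p with hb
  have hT : ‖S.tanF E φ p U‖ ^ 2 = ∑ i, (inner ℝ (D (b i)) (S.f (φ p) (D U)) : ℝ) ^ 2 :=
    VectorForm.norm_starProjection_range_sq b D.toLinearMap (hφ.isometric p) _
  have hηU : ∀ α, S.η α (φ p) (D U) = 0 := fun α ↦ by
    rw [S.η_eq_inner, real_inner_comm]
    exact hU α
  have hηb : ∀ α i, S.η α (φ p) (D (b i)) = inner ℝ (b i) (ζ α) := fun α i ↦ by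
    rw [S.η_eq_inner, ← hζ, real_inner_comm]
    exact hφ.isometric p _ _
  have hUU : (inner ℝ (D U) (D U) : ℝ) = 1 := by
    rw [hφ.isometric p U U, real_inner_self_eq_norm_sq, hU1, one_pow]
  have hUf : (inner ℝ (D U) (S.f (φ p) (D U)) : ℝ) = 0 := by
    have := S.inner_f_left (φ p) (D U) (D U)
    rw [real_inner_comm] at this
    linarith
  have hbU : ∀ i, (inner ℝ (D (b i)) (D U) : ℝ) = inner ℝ (b i) U := fun i ↦ hφ.isometric p _ _
  have hUb : ∀ i, (inner ℝ (D U) (D (b i)) : ℝ) = inner ℝ (b i) U := fun i ↦ by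
    rw [real_inner_comm, hbU]
  have hbb : ∀ i, (inner ℝ (D (b i)) (D (b i)) : ℝ) = 1 := fun i ↦ by
    rw [hφ.isometric p, real_inner_self_eq_norm_sq, b.norm_eq_one, one_pow]
  -- As `η α (D U) = 0`, the `F₃` term disappears, and `F₁ = F₂` turns the coefficient `3 F₂` into
  -- `3 F₁`. Upon summation the mixed `Fη` drop out by orthonormality of `ζ`, and the two diagonal
  -- ones lower `n + 1` to `n - 1`.
  have term : ∀ i, (inner ℝ (riemann (φ p) (D (b i)) (D U) (D U)) (D (b i)) : ℝ)
      = F₁ (φ p) * (1 - (inner ℝ (b i) U : ℝ) ^ 2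
          + 3 * (inner ℝ (D (b i)) (S.f (φ p) (D U)) : ℝ) ^ 2)
        - ∑ α, ∑ β, Fη α β (φ p) * ((inner ℝ (b i) (ζ α) : ℝ) * inner ℝ (b i) (ζ β)) := by
    intro i
    rw [hF.curvature_eq, R₁, R₂, R₃]
    simp only [Rη, hηU, hηb, hUU, hUf, hbU, mul_zero, zero_smul, sub_zero,
      add_zero, smul_zero, one_smul, one_mul, zero_sub, Fin.sum_univ_two, inner_add_left,
      inner_sub_left, inner_neg_left, real_inner_smul_left, hbb, hUb, ← hζ]
    have hζb : ∀ α, (inner ℝ (D (ζ α)) (D (b i)) : ℝ) = inner ℝ (b i) (ζ α) := fun α ↦ by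
      rw [hφ.isometric p, real_inner_comm]
    rw [hζb, hζb, real_inner_comm (D (b i)) (S.f (φ p) (D U)), ← hf]
    ring
  have hζo : ∀ α β, ∑ i, (inner ℝ (b i) (ζ α) : ℝ) * inner ℝ (b i) (ζ β)
      = if α = β then 1 else 0 := by
    intro α β
    rw [← S.inner_ξ_ξ α β (φ p), ← hζ, ← hζ, hφ.isometric p, ← b.sum_inner_mul_inner]
    exact Finset.sum_congr rfl fun i _ ↦ by rw [real_inner_comm]
  have hcard : ((Finset.univ : Finset (Fin (Module.finrank ℝ (TangentSpace 𝓘(ℝ, E) p)))).card : ℝ)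
      = (n : ℝ) + 2 := by
    rw [Finset.card_univ, Fintype.card_fin]
    exact_mod_cast hn
  rw [Finset.sum_congr rfl fun i _ ↦ term i, Finset.sum_sub_distrib, ← Finset.mul_sum,
    Finset.sum_add_distrib, Finset.sum_sub_distrib, ← Finset.mul_sum, ← hT,
    VectorForm.sum_inner_sq, hU1, Finset.sum_const, nsmul_eq_mul, hcard, Finset.sum_comm]
  have : ∀ α, ∑ i, ∑ β, Fη α β (φ p) * ((inner ℝ (b i) (ζ α) : ℝ) * inner ℝ (b i) (ζ β))
      = F₁ (φ p) := by
    intro α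
    rw [Finset.sum_comm]
    simp only [← Finset.mul_sum, hζo]
    simp [hη]
  simp only [this]
  simp
  ring

/-- The Gauss equation for the Ricci curvature. -/
theorem ricci_eq [FiniteDimensional ℝ E']
    [IsContMDiffRiemannianBundle 𝓘(ℝ, E') ∞ E' (fun q : M' ↦ TangentSpace 𝓘(ℝ, E') q)]
    [FiniteDimensional ℝ E] [IsManifold 𝓘(ℝ, E) ∞ M]
    [IsContMDiffRiemannianBundle 𝓘(ℝ, E) ∞ E (fun q : M ↦ TangentSpace 𝓘(ℝ, E) q)]
    {m n : ℕ} (hm : Module.finrank ℝ E' = 2 * m + 2)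
    (hn : Module.finrank ℝ E = n + 2) (hn2 : 2 ≤ n)
    (hC : S.IsCManifold) (hF : S.IsGeneralizedSSpaceForm F₁ F₂ F₃ Fη) (hF₁ : m = 1 → F₁ = F₂)
    (hφ : IsIsometricImmersion E E' φ) (hξ : S.IsTangentTo E φ) (p : M)
    (U : TangentSpace 𝓘(ℝ, E) p) (hU : U ∈ S.distL E φ p) (hU1 : ‖U‖ = 1) :
    ricci p U = (((n : ℝ) - 1) + 3 * ‖S.tanF E φ p U‖ ^ 2) * F₁ (φ p)
      + (inner ℝ (∑ i, sffForm E E' φ p (orthoBasis E p i) (orthoBasis E p i))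
          (sffForm E E' φ p U U)
        - ∑ i, ‖sffForm E E' φ p (orthoBasis E p i) U‖ ^ 2) := by
  obtain ⟨hη, hf⟩ := S.coeff_submanifold hm hn hn2 hC hF hF₁ hφ p U hU hU1
  choose ζ hζ using fun α ↦ hξ α p
  rw [← S.sum_inner_riemann hn hF hφ p hζ hη hf U hU hU1, sum_inner, ← Finset.sum_sub_distrib,
    ← Finset.sum_add_distrib, ricci]
  refine Finset.sum_congr rfl fun i _ ↦ ?_
  rw [hφ.gauss, hφ.sff_symm p U (orthoBasis E p i), ← sffForm_apply, ← sffForm_apply,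
    ← sffForm_apply, real_inner_self_eq_norm_sq, real_inner_comm (sffForm E E' φ p U U)]
  ring

end MetricFStructure

/-! ### The inequality and its equality case. -/

theorem mainTheorem4
    {E' : Type*} [NormedAddCommGroup E'] [NormedSpace ℝ E'] [FiniteDimensional ℝ E']
    {M' : Type*} [TopologicalSpace M'] [ChartedSpace E' M'] [IsManifold 𝓘(ℝ, E') ∞ M']
    [RiemannianBundle (fun q : M' ↦ TangentSpace 𝓘(ℝ, E') q)]
    [IsContMDiffRiemannianBundle 𝓘(ℝ, E') ∞ E' (fun q : M' ↦ TangentSpace 𝓘(ℝ, E') q)]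
    {E : Type*} [NormedAddCommGroup E] [NormedSpace ℝ E] [FiniteDimensional ℝ E]
    {M : Type*} [TopologicalSpace M] [ChartedSpace E M] [IsManifold 𝓘(ℝ, E) ∞ M]
    [RiemannianBundle (fun q : M ↦ TangentSpace 𝓘(ℝ, E) q)]
    [IsContMDiffRiemannianBundle 𝓘(ℝ, E) ∞ E (fun q : M ↦ TangentSpace 𝓘(ℝ, E) q)]
    (m n : ℕ) (hm : Module.finrank ℝ E' = 2 * m + 2) (hn : Module.finrank ℝ E = n + 2)
    (hn2 : 2 ≤ n)
    (S : MetricFStructure E' M' 2) (hC : S.IsCManifold)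
    (F₁ F₂ F₃ : M' → ℝ) (Fη : Fin 2 → Fin 2 → M' → ℝ)
    (hF : S.IsGeneralizedSSpaceForm F₁ F₂ F₃ Fη) (hF₁ : m = 1 → F₁ = F₂)
    (φ : M → M') (hφ : Immersed.IsIsometricImmersion E E' φ) (hξ : S.IsTangentTo E φ) :
    (∀ p : M, ∀ U ∈ S.distL E φ p, ‖U‖ = 1 →
      RiemannChart.ricci p U ≤ ((n : ℝ) + 2) ^ 2 / 4 * ‖Immersed.meanCurvature E E' φ p‖ ^ 2
        + (((n : ℝ) - 1) + 3 * ‖S.tanF E φ p U‖ ^ 2) * F₁ (φ p)) ∧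
    ((∀ p : M, ∀ U ∈ S.distL E φ p, ‖U‖ = 1 →
      RiemannChart.ricci p U = ((n : ℝ) + 2) ^ 2 / 4 * ‖Immersed.meanCurvature E E' φ p‖ ^ 2
        + (((n : ℝ) - 1) + 3 * ‖S.tanF E φ p U‖ ^ 2) * F₁ (φ p)) ↔
      (n = 2 ∧ S.IsTotallyFUmbilical E φ) ∨ (2 < n ∧ Immersed.IsTotallyGeodesic E E' φ)) := by
  choose ζ hζ using fun p α ↦ hξ α p
  have ric := fun p ↦ S.ricci_eq hm hn hn2 hC hF hF₁ hφ hξ p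
  have ζo : ∀ p, Orthonormal ℝ (ζ p) := fun p ↦ orthonormal_iff_ite.2 fun α β ↦ by
    rw [← hφ.isometric, hζ, hζ, S.inner_ξ_ξ]
  have symm : ∀ p u v, Immersed.sffForm E E' φ p u v = Immersed.sffForm E E' φ p v u :=
    fun p u v ↦ hφ.sff_symm p u v
  have σζ : ∀ p u α, Immersed.sffForm E E' φ p u (ζ p α) = 0 := fun p u α ↦
    S.sff_ξ hC hφ hξ p α u _ (hζ p α)
  have memL : ∀ p u, u ∈ S.distL E φ p ↔ ∀ α, (inner ℝ u (ζ p α) : ℝ) = 0 := by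
    intro p u
    refine forall_congr' fun α ↦ ?_
    rw [← hζ, hφ.isometric]
  have card : ∀ p : M, Fintype.card (Fin (Module.finrank ℝ (TangentSpace 𝓘(ℝ, E) p))) = n + 2 :=
    fun p ↦ (Fintype.card_fin _).trans hn
  simp only [Immersed.norm_meanCurvature_sq φ hn]
  refine ⟨fun p U hU hU1 ↦ ?_, fun heq ↦ ?_, ?_⟩
  · rw [ric p U hU hU1, add_comm]
    gcongr
    exact VectorForm.trace_sub_sq_le _ _ _ U hU1
  -- Cancelling the ambient part from `ric` and `heq` leaves equality in the completed square, a
  -- statement about `σ` alone.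
  · have e : ∀ p U, (∀ α, (inner ℝ U (ζ p α) : ℝ) = 0) → ‖U‖ = 1 → _ := fun p U hU hU1 ↦
      add_left_cancel ((ric p U ((memL p U).2 hU) hU1).symm.trans
        ((heq p U ((memL p U).2 hU) hU1).trans (add_comm _ _)))
    rcases hn2.eq_or_lt with h2 | h2
    -- The normal field is half the trace of `σ`, the factor dictated by the equality case.
    · refine Or.inl ⟨h2.symm, fun p ↦ (1 / 2 : ℝ) • ∑ i, Immersed.sffForm E E' φ p
        (RiemannChart.orthoBasis E p i) (RiemannChart.orthoBasis E p i), fun p u ↦ ?_,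
        fun p u hu v hv ↦ ?_⟩
      · rw [real_inner_smul_left, sum_inner]
        simp [Immersed.sffForm_apply, hφ.sff_normal]
      · exact VectorForm.umbilical_of_eq _ _ (e p) u v ((memL p v).1 hv)
    · exact Or.inr ⟨h2, fun p u v ↦
        VectorForm.eq_zero_of_eq _ (card p) h2 (ζo p) (symm p) (σζ p) (e p) u v⟩
  · rintro (⟨rfl, V, -, hV⟩ | ⟨-, h0⟩) p U hU hU1
    · rw [ric p U hU hU1, add_comm]
      congr 1
      exact VectorForm.eq_of_umbilical _ (card p) (ζo p) (symm p) (σζ p)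
        (fun u v hu hv ↦ hV p u ((memL p u).2 hu) v ((memL p v).2 hv)) U ((memL p U).1 hU) hU1
    · rw [ric p U hU hU1]
      have h1 : ∀ u v, Immersed.sffForm E E' φ p u v = 0 := h0 p
      simp [h1]
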